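/- **Setting.** For a real random variable $X$ let $\mu_p(X)=\mathbb E\{(X-\mathbb E X)^p\}$, and for $k\in\{1,2\}$ let $\|X\|_{\psi_k}=\inf\{t>0:\mathbb E\exp(|X|^k/t^k)\le 2\}$; $X$ is sub-exponential (resp. sub-gaussian) if $\|X\|_{\psi_1}<\infty$ (resp. $\|X\|_{\psi_2}<\infty$). For a random matrix $R=(r_{ij})\in\mathbb R^{m\times n}$ put $\mu_p(R)=\max_{i,j}|\mu_p(r_{ij})|$, $\|R\|_{\psi_k}=\max_{i,j}\|r_{ij}\|_{\psi_k}$ and $$K(R)=\mu_2(R)^2+\mu_3(R)+\mu_2(R)\mu_3(R)+\mu_4(R).$$ $R$ is *2-central* if all of its entries have the same $p$-th central moment for $p=1,2$ (i.e. the same variance). For a deterministic $M=(M_{ij})$ let $\|M\|_\infty=\max_{i,j}|M_{ij}|$. A matrix $A\in\mathbb R^{m\times n}$ satisfies $\ell_2$-$\mathrm{RNSP}(s,\rho,\tau)$ if $$\|v_S\|_2\le \frac{\rho}{\sqrt s}\,\|v_{\bar S}\|_1+\tau\|Av\|_2$$ for every $v\in\mathbb R^n$ and every $S\subseteq[n]$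 with $|S|\le s$, where $\bar S=[n]\setminus S$. **Statement.** (1) There is an absolute constant $C>0$ such that the following holds. Let $k\in\{1,2\}$, let $M\in\mathbb R^{m\times n}$ be a fixed matrix, and let $R\in\mathbb R^{m\times n}$ be a 2-central random matrix with independent (not necessarily identically distributed) entries, each of finite $\psi_k$-norm, and with $\mu_2(R)>0$. If $\rho\in(0,1)$, $\tau>0$, $s\in[n]$ and $$m\ \ge\ C\left(\frac{K(R)}{\mu_2(R)^{5/2}\,\tau}\Big(1+\tau\rho^{-1}\sqrt{s\log n}\,\big(\|R\|_{\psi_k}+\|M\|_\infty\big)\Big)\right)^2,$$ then $M+R$ satisfies $\ell_2$-$\mathrm{RNSP}(s,\rho,\tau)$ with probability at least $1-\exp\left(-\frac{\mu_2(R)^4}{K(R)^2}\,m\right)$. (2) Consequently, if $s\le n^{1-\varepsilon}$ and all other quantities are bounded independently of $s$ and $n$, then a number of measurements of order $s\log(n/s)$ suffices. Precisely: for all $\varepsilon,\rho\in(0,1)$, $\tau,v>0$ and $\kappa,b\in\mathbb R$ there is $C_0>0$, depending only on $\varepsilon,\rho,\tau,v,\kappa,b$, such that for $k\in\{1,2\}$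 and all $M,R$ as in (1) with $\mu_2(R)\ge v$, $K(R)\le\kappa$, $\|R\|_{\psi_k}\le b$, $\|M\|_\infty\le b$, and all $n\ge 2$, $1\le s\le n^{1-\varepsilon}$ and $m\ge C_0\, s\log(n/s)$, the matrix $M+R$ satisfies $\ell_2$-$\mathrm{RNSP}(s,\rho,\tau)$ with probability at least $1-\exp\left(-\frac{v^4}{\kappa^2}\,m\right)$. -/

import Mathlib

open MeasureTheory ProbabilityTheory
open scoped Matrix ENNReal

noncomputable section

/-- `IsL2RNSP A s ρ τ`: the matrix `A` satisfies `ℓ₂-RNSP(s, ρ, τ)`, the `ℓ₂`-robust null space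
property of order `s`: for every index set `S` with `|S| ≤ s` and every vector `v`,
`‖v_S‖₂ ≤ (ρ / √s) ‖v_{Sᶜ}‖₁ + τ ‖A v‖₂`. -/
def IsL2RNSP {m n : ℕ} (A : Matrix (Fin m) (Fin n) ℝ) (s : ℕ) (ρ τ : ℝ) : Prop :=
  ∀ S : Finset (Fin n), S.card ≤ s → ∀ v : Fin n → ℝ,
    √(∑ j ∈ S, v j ^ 2) ≤
      ρ / √(s : ℝ) * ∑ j ∈ Sᶜ, |v j| + τ * √(∑ i, (A *ᵥ v) i ^ 2)

/-- The entrywise maximum norm `‖M‖_∞ = max_{i,j} |M i j|`. -/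
def entryMaxNorm {m n : ℕ} (M : Matrix (Fin m) (Fin n) ℝ) : ℝ :=
  ⨆ p : Fin m × Fin n, |M p.1 p.2|

section Moments

variable {Ω : Type*} [MeasurableSpace Ω]

/-- The random matrix `R` is `k`-central: for `1 ≤ p ≤ k`, all entries have the same `p`-th
central moment. -/
def IsCentral {m n : ℕ} (k : ℕ) (R : Ω → Matrix (Fin m) (Fin n) ℝ) (P : Measure Ω) : Prop :=
  ∀ p : ℕ, 1 ≤ p → p ≤ k → ∀ (i i' : Fin m) (j j' : Fin n),
    centralMoment (fun ω => R ω i j) p P = centralMoment (fun ω => R ω i' j') p P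

/-- `μ_k(R) = max_{i,j} |μ_k(R i j)|`, with `μ_k` the `k`-th central moment. -/
def matMoment {m n : ℕ} (k : ℕ) (R : Ω → Matrix (Fin m) (Fin n) ℝ) (P : Measure Ω) : ℝ :=
  ⨆ p : Fin m × Fin n, |centralMoment (fun ω => R ω p.1 p.2) k P|

/-- `K(R) = μ₂(R)² + μ₃(R) + μ₂(R) μ₃(R) + μ₄(R)`. -/
def matK {m n : ℕ} (R : Ω → Matrix (Fin m) (Fin n) ℝ) (P : Measure Ω) : ℝ :=
  matMoment 2 R P ^ 2 + matMoment 3 R P + matMoment 2 R P * matMoment 3 R P + matMoment 4 R P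

/-- The set of `t > 0` with `𝔼 exp(|X|^k / t^k) ≤ 2` (the expectation may be infinite). -/
def psiSet (k : ℕ) (X : Ω → ℝ) (P : Measure Ω) : Set ℝ :=
  {t : ℝ | 0 < t ∧ ∫⁻ ω, ENNReal.ofReal (Real.exp (|X ω| ^ k / t ^ k)) ∂P ≤ 2}

/-- The `ψ_k`-norm `‖X‖_{ψ_k} = inf {t > 0 : 𝔼 exp(|X|^k / t^k) ≤ 2}`: the sub-exponential norm
for `k = 1` and the sub-gaussian norm for `k = 2`. -/
def psiNorm (k : ℕ) (X : Ω → ℝ) (P : Measure Ω) : ℝ :=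
  sInf (psiSet k X P)

/-- `X` has finite `ψ_k`-norm: it is sub-exponential (`k = 1`) or sub-gaussian (`k = 2`). -/
def HasFinitePsiNorm (k : ℕ) (X : Ω → ℝ) (P : Measure Ω) : Prop :=
  (psiSet k X P).Nonempty

/-- `‖R‖_{ψ_k} = max_{i,j} ‖R i j‖_{ψ_k}`. -/
def matPsiNorm {m n : ℕ} (k : ℕ) (R : Ω → Matrix (Fin m) (Fin n) ℝ) (P : Measure Ω) : ℝ :=
  ⨆ p : Fin m × Fin n, psiNorm k (fun ω => R ω p.1 p.2) P

/-- A random matrix with independent entries of finite `ψ_k`-norm, not necessarily identically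
distributed: a sub-exponential (`k = 1`) or sub-gaussian (`k = 2`) random matrix. -/
structure IsPsiMatrix {m n : ℕ} (k : ℕ) (R : Ω → Matrix (Fin m) (Fin n) ℝ)
    (P : Measure Ω) : Prop where
  measurable : ∀ i j, Measurable fun ω => R ω i j
  indep : iIndepFun (fun (p : Fin m × Fin n) (ω : Ω) => R ω p.1 p.2) P
  finitePsi : ∀ i j, HasFinitePsiNorm k (fun ω => R ω i j) P

end Moments

end

/-! Write σ = μ₂(R), β = σ²/K(R) and A = M + R. A vector violating the null space property becomes,
after normalisation, a unit vector with ‖v‖₁ ≤ 2√s/ρ and ‖Av‖₂ < 1/τ (`isL2RNSP_of_forall_le`). It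
is therefore enough to bound ‖Av‖₂ below uniformly over such v, and this is done by the small ball
method.

For one unit vector v and one row, the inner product is a + Y with a deterministic and Y centered of
variance σ. Paley–Zygmund for the second and fourth moments gives mean at least (13/20)β for a
Lipschitz substitute (`ramp`) of the indicator that the inner product exceeds √σ/20 in absolute
value, whatever the shift a is (`le_integral_ramp_sum`). The cross term 4a·E Y³ is the reason why
K(R) involves μ₃.

Uniformity in v comes from an empirical process bound. `integral_exp_supLike_sum_le` performs
concentration (Hoeffding's lemma, one coordinate at a time) and symmetrization with contraction in a
single induction. What remains is the expected supremum of a signed linear process. By ℓ₁–ℓ∞ duality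
it is at most the ℓ₁ radius times a maximum over the n columns (`integral_iSup_boolSign_le`). The
random signs produce hyperbolic cosines, so neither M nor the means of R have to vanish. The
hypothesis forces m ≥ 1000 log n, so the exponential parameter stays in the range where
sub-exponential entries behave like sub-gaussian ones, and ψ₁ control is enough.

The exponent β²m has constant exactly 1. Single rows with mean q = (13/20)β would only give about
2q²m < β²m. Grouping the rows in N ≈ m/2 pairs and asking that at least one member of a pair be
large raises the mean to q(2 - q) > (21/20)β, and 2(21/20)²β²N exceeds β²m.

For the second part, s ≤ n^(1-ε) gives log(n/s) ≥ ε log n, so the bound of the first part is of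
order s log(n/s). -/

/-- A monotone functional on `ι → ℝ` which grows by at most `c` when its argument is shifted up by
the constant `c ≥ 0`, such as the maximum of the coordinates. -/
structure IsSupLike {ι : Type*} (G : (ι → ℝ) → ℝ) : Prop where
  mono : Monotone G
  add_const_le : ∀ (h : ι → ℝ) (c : ℝ), 0 ≤ c → G (h + fun _ => c) ≤ G h + c

/-! ### Supremum-type functionals and Hoeffding's lemma for them -/

section SupLike

variable {ι : Type*} [Fintype ι]

lemma isSupLike_iSup [Nonempty ι] : IsSupLike (fun h : ι → ℝ => ⨆ v, h v) where
  mono := fun _ _ hfg => ciSup_mono (Set.finite_range _).bddAbove hfg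
  add_const_le := fun h c _ => ciSup_le fun v => by
    simpa using le_ciSup (Set.finite_range h).bddAbove v

lemma IsSupLike.le_add_norm {G : (ι → ℝ) → ℝ} (hG : IsSupLike G) (f g : ι → ℝ) :
    G f ≤ G g + ‖f - g‖ := by
  refine le_trans (hG.mono fun v => ?_) (hG.add_const_le g ‖f - g‖ (norm_nonneg _))
  have h : |f v - g v| ≤ ‖f - g‖ := norm_le_pi_norm (f - g) v
  have := (abs_le.1 h).2
  simp only [Pi.add_apply]
  linarith

lemma IsSupLike.continuous {G : (ι → ℝ) → ℝ} (hG : IsSupLike G) : Continuous G := by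
  refine (LipschitzWith.of_le_add fun f g => ?_).continuous
  simpa [dist_eq_norm] using hG.le_add_norm f g

lemma integrable_norm_pi {E : Type*} [MeasurableSpace E] {ν : Measure E} {Y : E → ι → ℝ}
    (hYi : ∀ v, Integrable (fun y => Y y v) ν) : Integrable (fun y => ‖Y y‖) ν :=
  (Integrable.of_eval hYi).norm

lemma IsSupLike.integrable {G : (ι → ℝ) → ℝ} (hG : IsSupLike G) {E : Type*} [MeasurableSpace E]
    {ν : Measure E} [IsFiniteMeasure ν] {Y : E → ι → ℝ}
    (hYi : ∀ v, Integrable (fun y => Y y v) ν) (h : ι → ℝ) :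
    Integrable (fun y => G (h + Y y)) ν := by
  refine Integrable.mono' ((integrable_const |G h|).add (integrable_norm_pi hYi)) ?_ ?_
  · have hY : AEStronglyMeasurable Y ν := (Integrable.of_eval hYi).aestronglyMeasurable
    exact hG.continuous.comp_aestronglyMeasurable (hY.const_add h)
  · refine Filter.Eventually.of_forall fun y => ?_
    have h1 := hG.le_add_norm (h + Y y) h
    have h2 := hG.le_add_norm h (h + Y y)
    simp only [add_sub_cancel_left, sub_add_cancel_left, norm_neg] at h1 h2
    rw [Real.norm_eq_abs, abs_le]
    simp only [Pi.add_apply]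
    constructor <;> linarith [neg_abs_le (G h), le_abs_self (G h)]

/-- Stability under averaging keeps the induction in `integral_exp_supLike_sum_le` inside one class:
integrating out a replaced summand leaves a functional of the same kind. -/
lemma IsSupLike.average {G : (ι → ℝ) → ℝ} (hG : IsSupLike G) {E : Type*} [MeasurableSpace E]
    {ν : Measure E} [IsProbabilityMeasure ν] {Y : E → ι → ℝ}
    (hYi : ∀ v, Integrable (fun y => Y y v) ν) :
    IsSupLike (fun h => ∫ y, G (h + Y y) ∂ν) where
  mono := fun f g hfg => integral_mono (hG.integrable hYi f) (hG.integrable hYi g) fun y =>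
    hG.mono (by gcongr)
  add_const_le := fun h c hc => by
    have : ∫ y, G (h + Y y) ∂ν + c = ∫ y, (G (h + Y y) + c) ∂ν := by
      rw [integral_add (hG.integrable hYi h) (integrable_const c)]; simp
    rw [this]
    refine integral_mono (hG.integrable hYi _) ((hG.integrable hYi h).add (integrable_const c))
      fun y => ?_
    have := hG.add_const_le (h + Y y) c hc
    rwa [add_right_comm] at this

/-- Hoeffding's lemma for a sup-like functional of a vector with coordinates in unit intervals. -/
lemma IsSupLike.integral_exp_le {G : (ι → ℝ) → ℝ} (hG : IsSupLike G) {E : Type*}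
    [MeasurableSpace E] {μ : Measure E} [IsProbabilityMeasure μ] {d : E → ι → ℝ}
    (hd : Measurable d) {a : ι → ℝ} (hda : ∀ x v, a v ≤ d x v) (hdb : ∀ x v, d x v ≤ a v + 1)
    (lam : ℝ) (h : ι → ℝ) :
    ∫ x, Real.exp (lam * G (h + d x)) ∂μ ≤
      Real.exp (lam ^ 2 / 8 + lam * ∫ x, G (h + d x) ∂μ) := by
  have hm : Measurable fun x => G (h + d x) :=
    hG.continuous.measurable.comp (hd.const_add h)
  have hb : ∀ᵐ x ∂μ, G (h + d x) ∈ Set.Icc (G (h + a)) (G (h + a) + 1) := by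
    refine Filter.Eventually.of_forall fun x => ⟨hG.mono fun v => ?_, ?_⟩
    · simpa using hda x v
    · refine le_trans (hG.mono fun v => ?_) (hG.add_const_le (h + a) 1 zero_le_one)
      simp only [Pi.add_apply]
      linarith [hdb x v]
  have key := (hasSubgaussianMGF_of_mem_Icc hm.aemeasurable hb).mgf_le lam
  simp only [mgf, add_sub_cancel_left, nnnorm_one] at key
  set I := ∫ x, G (h + d x) ∂μ
  have e : (fun x => Real.exp (lam * G (h + d x))) =
      fun x => Real.exp (lam * I) * Real.exp (lam * (G (h + d x) - I)) := by
    ext x; rw [← Real.exp_add]; congr 1; ring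
  rw [e, integral_const_mul, add_comm, Real.exp_add]
  gcongr
  refine key.trans (le_of_eq ?_)
  congr 1
  push_cast
  ring

end SupLike

/-! ### Integration over finite products -/

section Pi

variable {E : Type*} [MeasurableSpace E]

lemma integral_pi_succ {N : ℕ} (μ : Fin (N + 1) → Measure E) [∀ l, IsProbabilityMeasure (μ l)]
    {f : (Fin (N + 1) → E) → ℝ} (hf : Integrable f (Measure.pi μ)) :
    ∫ x, f x ∂Measure.pi μ =
      ∫ x' : Fin N → E, ∫ x₀, f (Fin.cons x₀ x') ∂μ 0 ∂Measure.pi fun l => μ l.succ := by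
  have hp := (measurePreserving_piFinSuccAbove μ 0).symm
  have hi := hf
  rw [← hp.integrable_comp_emb (MeasurableEquiv.measurableEmbedding _)] at hi
  rw [← hp.integral_comp']
  refine (integral_prod_symm _ hi).trans ?_
  simp [Fin.insertNthEquiv]

lemma integrable_pi_eval {κ : Type*} [Fintype κ] (μ : κ → Measure E)
    [∀ l, IsProbabilityMeasure (μ l)] {l : κ} {f : E → ℝ} (hf : Integrable f (μ l)) :
    Integrable (fun x : κ → E => f (x l)) (Measure.pi μ) :=
  (measurePreserving_eval μ l).integrable_comp_of_integrable hf

end Pi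

/-! ### Exponential moments by successive replacement -/

section Main

variable {ι : Type*} [Fintype ι] {E E' : Type*} [MeasurableSpace E] [MeasurableSpace E']

/-- Replacing the summands of an empirical process one at a time by their majorants. -/
theorem integral_exp_supLike_sum_le {lam : ℝ} (hlam : 0 ≤ lam) :
    ∀ (N : ℕ) (μ : Fin N → Measure E) [∀ l, IsProbabilityMeasure (μ l)]
      (ν : Fin N → Measure E') [∀ l, IsProbabilityMeasure (ν l)]
      (d : Fin N → E → ι → ℝ) (a : Fin N → ι → ℝ) (Y : Fin N → E' → ι → ℝ)
      (_ : ∀ l, Measurable (d l)) (_ : ∀ l x v, a l v ≤ d l x v)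
      (_ : ∀ l x v, d l x v ≤ a l v + 1) (_ : ∀ l v, Integrable (fun y => Y l y v) (ν l))
      (G : (ι → ℝ) → ℝ) (_ : IsSupLike G)
      (_ : ∀ l h, ∫ x, G (h + d l x) ∂μ l ≤ ∫ y, G (h + Y l y) ∂ν l),
      ∫ x, Real.exp (lam * G (∑ l, d l (x l))) ∂Measure.pi μ ≤
        Real.exp (lam ^ 2 / 8 * N + lam * ∫ y, G (∑ l, Y l (y l)) ∂Measure.pi ν) := by
  intro N
  induction N with
  | zero => intro μ _ ν _ d a Y _ _ _ _ G _ _; simp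
  | succ N ih =>
    intro μ _ ν _ d a Y hd hda hdb hY G hG hstep
    have hdi : ∀ l v, Integrable (fun x => d l x v) (μ l) := fun l v =>
      Integrable.of_mem_Icc (a l v) (a l v + 1) ((measurable_pi_iff.1 (hd l) v).aemeasurable)
        (Filter.Eventually.of_forall fun x => ⟨hda l x v, hdb l x v⟩)
    have hYsum : ∀ v, Integrable (fun y : Fin (N + 1) → E' => (∑ l, Y l (y l)) v)
        (Measure.pi ν) := fun v => by
      simp only [Finset.sum_apply]
      exact integrable_finsetSum _ fun l _ => integrable_pi_eval ν (hY l v)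
    have hYsum' : ∀ v, Integrable (fun y : Fin N → E' => (∑ l, Y l.succ (y l)) v)
        (Measure.pi fun l => ν l.succ) := fun v => by
      simp only [Finset.sum_apply]
      exact integrable_finsetSum _ fun l _ =>
        integrable_pi_eval (fun l : Fin N => ν l.succ) (hY l.succ v)
    -- Given the other coordinates, Hoeffding's lemma for coordinate 0 costs `lam ^ 2 / 8` and
    -- leaves a conditional mean, which `hstep` bounds by `G'`. The induction hypothesis is then
    -- applied to `G'`.
    set G' : (ι → ℝ) → ℝ := fun h => ∫ y, G (h + Y 0 y) ∂ν 0 with hG'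
    have hG's : IsSupLike G' := hG.average (hY 0)
    have hstep' : ∀ (l : Fin N) h, ∫ x, G' (h + d l.succ x) ∂μ l.succ ≤
        ∫ y, G' (h + Y l.succ y) ∂ν l.succ := by
      intro l h
      have i1 : Integrable (Function.uncurry fun x y => G (h + d l.succ x + Y 0 y))
          ((μ l.succ).prod (ν 0)) := by
        have := hG.integrable (ν := (μ l.succ).prod (ν 0))
          (Y := fun z => d l.succ z.1 + Y 0 z.2)
          (fun v => ((hdi l.succ v).comp_fst (ν 0)).add ((hY 0 v).comp_snd (μ l.succ))) h
        simpa only [Function.uncurry_def, add_assoc] using this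
      have i2 : Integrable (Function.uncurry fun x y => G (h + Y l.succ x + Y 0 y))
          ((ν l.succ).prod (ν 0)) := by
        have := hG.integrable (ν := (ν l.succ).prod (ν 0))
          (Y := fun z => Y l.succ z.1 + Y 0 z.2)
          (fun v => ((hY l.succ v).comp_fst (ν 0)).add ((hY 0 v).comp_snd (ν l.succ))) h
        simpa only [Function.uncurry_def, add_assoc] using this
      simp only [hG']
      -- With the average over `Y 0` outermost, the comparison for `G` applies at the shifted point
      -- `h + Y 0 y`.
      rw [integral_integral_swap i1, integral_integral_swap i2]
      refine integral_mono i1.integral_prod_right i2.integral_prod_right fun y => ?_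
      have := hstep l.succ (h + Y 0 y)
      simpa only [add_right_comm] using this
    have hGsum : Measurable fun x : Fin (N + 1) → E => G (∑ l, d l (x l)) :=
      hG.continuous.measurable.comp
        (Finset.measurable_sum _ fun l _ => (hd l).comp (measurable_pi_apply l))
    have hGsum' : Measurable fun x : Fin N → E => G' (∑ l, d l.succ (x l)) :=
      hG's.continuous.measurable.comp
        (Finset.measurable_sum _ fun l _ => (hd l.succ).comp (measurable_pi_apply l))
    have hbdd : ∀ (n : ℕ) (d : Fin n → E → ι → ℝ) (a : Fin n → ι → ℝ)
        (_ : ∀ l x v, a l v ≤ d l x v) (_ : ∀ l x v, d l x v ≤ a l v + 1)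
        (F : (ι → ℝ) → ℝ) (_ : IsSupLike F) (x : Fin n → E),
        lam * F (∑ l, d l (x l)) ∈
          Set.Icc (lam * F (∑ l, a l)) (lam * (F (∑ l, a l) + n)) := by
      intro n d a h1 h2 F hF x
      refine ⟨mul_le_mul_of_nonneg_left (hF.mono ?_) hlam,
        mul_le_mul_of_nonneg_left (le_trans (hF.mono ?_) (hF.add_const_le _ n n.cast_nonneg))
          hlam⟩
      · exact Finset.sum_le_sum fun l _ v => h1 l (x l) v
      · intro v
        simp only [Finset.sum_apply, Pi.add_apply]
        calc ∑ l, d l (x l) v ≤ ∑ l, (a l v + 1) := Finset.sum_le_sum fun l _ => h2 l (x l) v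
          _ = _ := by simp [Finset.sum_add_distrib]
    have hexp : ∀ {T : Type _} [MeasurableSpace T] (π : Measure T) [IsProbabilityMeasure π]
        (f : T → ℝ) (u w : ℝ), Measurable f → (∀ x, f x ∈ Set.Icc u w) →
        Integrable (fun x => Real.exp (f x)) π := by
      intro T _ π _ f u w hf hfb
      exact Integrable.of_mem_Icc (Real.exp u) (Real.exp w) hf.exp.aemeasurable
        (Filter.Eventually.of_forall fun x =>
          ⟨Real.exp_le_exp.2 (hfb x).1, Real.exp_le_exp.2 (hfb x).2⟩)
    have hint := hexp (Measure.pi μ) _ _ _ (hGsum.const_mul lam) (hbdd _ d a hda hdb G hG)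
    have hint' := hexp (Measure.pi fun l : Fin N => μ l.succ) _ _ _ (hGsum'.const_mul lam)
      (hbdd _ (fun l => d l.succ) (fun l => a l.succ) (fun l => hda l.succ)
        (fun l => hdb l.succ) G' hG's)
    have hint0 : Integrable (fun x' : Fin N → E => ∫ x₀, Real.exp (lam *
        G (∑ l, d l ((Fin.cons x₀ x' : Fin (N + 1) → E) l))) ∂μ 0)
        (Measure.pi fun l => μ l.succ) := by
      have hp := (measurePreserving_piFinSuccAbove μ 0).symm
      have hi := hint
      rw [← hp.integrable_comp_emb (MeasurableEquiv.measurableEmbedding _)] at hi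
      have := hi.integral_prod_right
      simpa [Fin.insertNthEquiv] using this
    rw [integral_pi_succ μ hint]
    have hle : ∀ x' : Fin N → E, ∫ x₀, Real.exp (lam *
        G (∑ l, d l ((Fin.cons x₀ x' : Fin (N + 1) → E) l))) ∂μ 0 ≤
        Real.exp (lam ^ 2 / 8) * Real.exp (lam * G' (∑ l, d l.succ (x' l))) := by
      intro x'
      rw [← Real.exp_add]
      simp only [Fin.sum_univ_succ, Fin.cons_zero, Fin.cons_succ]
      have h1 := hG.integral_exp_le (μ := μ 0) (hd 0) (hda 0) (hdb 0) lam
        (∑ l : Fin N, d l.succ (x' l))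
      have h2 := hstep 0 (∑ l : Fin N, d l.succ (x' l))
      simp only [add_comm (d 0 _)]
      refine h1.trans (Real.exp_le_exp.2 ?_)
      have := mul_le_mul_of_nonneg_left h2 hlam
      linarith
    refine (integral_mono hint0 (hint'.const_mul _) hle).trans ?_
    rw [integral_const_mul]
    have := ih (fun l => μ l.succ) (fun l => ν l.succ) (fun l => d l.succ) (fun l => a l.succ)
      (fun l => Y l.succ) (fun l => hd l.succ) (fun l => hda l.succ) (fun l => hdb l.succ)
      (fun l => hY l.succ) G' hG's hstep'
    refine (mul_le_mul_of_nonneg_left this (Real.exp_pos _).le).trans ?_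
    rw [← Real.exp_add]
    have hGY : Integrable (fun y : Fin (N + 1) → E' => G (∑ l, Y l (y l))) (Measure.pi ν) := by
      simpa using hG.integrable hYsum 0
    rw [integral_pi_succ ν hGY]
    simp only [Fin.sum_univ_succ, Fin.cons_zero, Fin.cons_succ, hG', add_comm (Y 0 _)]
    apply le_of_eq
    congr 1
    push_cast
    ring

end Main

/-! ### Symmetrization, contraction and the deviation inequality -/

section Contraction

/-- The sign `±1` attached to a Boolean. -/
def boolSign (b : Bool) : ℝ := if b then 1 else -1

/-- The law of two independent fair Booleans. -/
noncomputable def fairBoolPair : Measure (Bool × Bool) :=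
  (PMF.uniformOfFintype (Bool × Bool)).toMeasure

instance : IsProbabilityMeasure fairBoolPair := by
  unfold fairBoolPair; infer_instance

lemma integral_fairBoolPair (f : Bool × Bool → ℝ) :
    ∫ b, f b ∂fairBoolPair =
      (f (true, true) + f (true, false) + f (false, true) + f (false, false)) / 4 := by
  rw [fairBoolPair, PMF.integral_eq_sum]
  simp [Fintype.sum_prod_type]
  ring

variable {ι : Type*} [Fintype ι] [Nonempty ι]

/-- Vector contraction principle for one symmetrized summand. -/
lemma iSup_add_iSup_le_average (h φ x y : ι → ℝ)
    (hφ : ∀ v w, φ v - φ w ≤ |x v - x w| + |y v - y w|) :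
    ((⨆ v, (h v + φ v)) + ⨆ v, (h v - φ v)) / 2 ≤
      ∫ b, (⨆ v, (h v + 2 * (boolSign b.1 * x v + boolSign b.2 * y v))) ∂fairBoolPair := by
  rw [integral_fairBoolPair]
  set P : Bool → Bool → ℝ := fun b c =>
    ⨆ v, (h v + 2 * (boolSign b * x v + boolSign c * y v)) with hP
  change _ ≤ (P true true + P true false + P false true + P false false) / 4
  have hle : ∀ b c v, h v + 2 * (boolSign b * x v + boolSign c * y v) ≤ P b c := fun b c v =>
    le_ciSup (f := fun v => h v + 2 * (boolSign b * x v + boolSign c * y v))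
      (Set.finite_range _).bddAbove v
  -- Let the x-increment be the larger one. For the two sign pairs whose first sign is that of x v -
  -- x w, test the supremum at v, and for the other two at w. The y-terms cancel and 4|x v - x w|
  -- remains in the sum, which after halving covers both increments. The factor 2 inside the
  -- supremum pays for bounding their sum by twice the larger.
  have key : ∀ v w, (h v + φ v) + (h w - φ w) ≤
      (P true true + P true false + P false true + P false false) / 2 := by
    intro v w
    have a1 := hle true true v
    have a2 := hle true false v
    have a3 := hle false true v
    have a4 := hle false false v
    have b1 := hle true true w
    have b2 := hle true false w
    have b3 := hle false true w
    have b4 := hle false false w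
    have := hφ v w
    simp only [boolSign, if_true, Bool.false_eq_true, if_false] at a1 a2 a3 a4 b1 b2 b3 b4
    rcases abs_cases (x v - x w) with ⟨e1, _⟩ | ⟨e1, _⟩ <;>
    rcases abs_cases (y v - y w) with ⟨e2, _⟩ | ⟨e2, _⟩ <;>
    rcases le_total (|x v - x w|) (|y v - y w|) with e3 | e3 <;>
    rw [e1, e2] at this e3 <;> linarith
  have h1 : ∀ w, (⨆ v, (h v + φ v)) ≤
      (P true true + P true false + P false true + P false false) / 2 - (h w - φ w) :=
    fun w => ciSup_le fun v => by linarith [key v w]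
  have h2 : (⨆ w, (h w - φ w)) ≤
      (P true true + P true false + P false true + P false false) / 2 - ⨆ v, (h v + φ v) :=
    ciSup_le fun w => by linarith [h1 w]
  linarith

variable {E : Type*} [MeasurableSpace E]

lemma integrable_boolSign_combo {μ : Measure E} [IsProbabilityMeasure μ] {f g : E → ℝ}
    (hf : Integrable f μ) (hg : Integrable g μ) (c : ℝ) :
    Integrable (fun z : E × Bool × Bool =>
      c * (boolSign z.2.1 * f z.1 + boolSign z.2.2 * g z.1)) (μ.prod fairBoolPair) := by
  have e1 := hf.mul_prod (ν := fairBoolPair) (g := fun b => boolSign b.1) .of_finite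
  have e2 := hg.mul_prod (ν := fairBoolPair) (g := fun b => boolSign b.2) .of_finite
  simpa only [mul_comm (boolSign _), Pi.add_apply] using (e1.add e2).const_mul c

/-- Symmetrization and contraction for a single summand. -/
lemma integral_iSup_sub_le {μ : Measure E} [IsProbabilityMeasure μ] {g x y : ι → E → ℝ} {c : ℝ}
    (hg : ∀ v, Integrable (g v) μ) (hx : ∀ v, Integrable (x v) μ) (hy : ∀ v, Integrable (y v) μ)
    (hlip : ∀ e v w, g v e - g w e ≤ c * (|x v e - x w e| + |y v e - y w e|)) (hc : 0 ≤ c)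
    (h : ι → ℝ) :
    ∫ e, (⨆ v, (h v + (∫ e', g v e' ∂μ - g v e))) ∂μ ≤
      ∫ z, (⨆ v, (h v + 4 * c * (boolSign z.2.1 * x v z.1 + boolSign z.2.2 * y v z.1)))
        ∂(μ.prod fairBoolPair) := by
  have hS := isSupLike_iSup (ι := ι)
  have i1 := hS.integrable (ν := μ) (Y := fun e v => ∫ e', g v e' ∂μ - g v e)
    (fun v => (integrable_const _).sub (hg v)) h
  have ip := hS.integrable (ν := μ) (Y := fun e v => 2 * g v e) (fun v => (hg v).const_mul 2) h
  have im := hS.integrable (ν := μ) (Y := fun e v => -(2 * g v e))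
    (fun v => ((hg v).const_mul 2).neg) h
  simp only [Pi.add_apply, ← sub_eq_add_neg] at i1 ip im
  have iz := hS.integrable (ν := μ.prod fairBoolPair)
    (Y := fun z v => 4 * c * (boolSign z.2.1 * x v z.1 + boolSign z.2.2 * y v z.1))
    (fun v => integrable_boolSign_combo (hx v) (hy v) (4 * c)) h
  simp only [Pi.add_apply] at iz
  rw [integral_prod _ iz]
  -- Write h + E g - g as the mean of h + 2 E g and h - 2g and move the expectation out of the first
  -- supremum. Symmetrization then needs no independent copy and no sign on g.
  have s1 : ∀ e, (⨆ v, (h v + (∫ e', g v e' ∂μ - g v e))) ≤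
      ((∫ e', ⨆ v, (h v + 2 * g v e') ∂μ) + ⨆ v, (h v - 2 * g v e)) / 2 := by
    intro e
    refine ciSup_le fun v => ?_
    have t1 : ∫ e', (h v + 2 * g v e') ∂μ ≤ ∫ e', ⨆ v, (h v + 2 * g v e') ∂μ :=
      integral_mono ((integrable_const _).add ((hg v).const_mul 2)) ip fun e' =>
        le_ciSup (f := fun v => h v + 2 * g v e') (Set.finite_range _).bddAbove v
    rw [integral_add (integrable_const _) ((hg v).const_mul 2), integral_const_mul] at t1
    have t2 : h v - 2 * g v e ≤ ⨆ v, (h v - 2 * g v e) :=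
      le_ciSup (f := fun v => h v - 2 * g v e) (Set.finite_range _).bddAbove v
    simp only [integral_const, probReal_univ, one_smul] at t1
    linarith
  refine (integral_mono i1 (((integrable_const _).add im).div_const 2) s1).trans ?_
  have s2 : ∫ e, ((∫ e', ⨆ v, (h v + 2 * g v e') ∂μ) + ⨆ v, (h v - 2 * g v e)) / 2 ∂μ =
      ∫ e, ((⨆ v, (h v + 2 * g v e)) + ⨆ v, (h v - 2 * g v e)) / 2 ∂μ := by
    rw [integral_div, integral_div, integral_add (integrable_const _) im, integral_add ip im]
    simp
  simp only [Pi.add_apply]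
  rw [s2]
  refine integral_mono ((ip.add im).div_const 2) iz.integral_prod_left fun e => ?_
  have := iSup_add_iSup_le_average h (fun v => 2 * g v e) (fun v => 2 * c * x v e)
    (fun v => 2 * c * y v e) (fun v w => by
      have := hlip e v w
      rw [← mul_sub, ← mul_sub, ← mul_sub, abs_mul (2 * c), abs_mul (2 * c),
        abs_of_nonneg (by positivity : 0 ≤ 2 * c)]
      linarith)
  refine this.trans (le_of_eq ?_)
  congr 1
  ext b
  congr 1
  ext v
  ring

/-- Uniform deviation inequality for an empirical process over a finite index set, whose summands
take values in `[0, 1]` and are Lipschitz functions of two real processes. -/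
theorem measureReal_exists_sum_integral_sub_ge_le {N : ℕ} {μ : Fin N → Measure E}
    [∀ l, IsProbabilityMeasure (μ l)] {g x y : Fin N → ι → E → ℝ} {c : ℝ}
    (hg : ∀ l v, Measurable (g l v)) (hg0 : ∀ l v e, 0 ≤ g l v e) (hg1 : ∀ l v e, g l v e ≤ 1)
    (hx : ∀ l v, Integrable (x l v) (μ l)) (hy : ∀ l v, Integrable (y l v) (μ l))
    (hlip : ∀ l e v w, g l v e - g l w e ≤ c * (|x l v e - x l w e| + |y l v e - y l w e|))
    (hc : 0 ≤ c) {D t : ℝ} (ht : 0 ≤ t)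
    (hD : ∫ z, (⨆ v, ∑ l, 4 * c * (boolSign (z l).2.1 * x l v (z l).1 +
      boolSign (z l).2.2 * y l v (z l).1)) ∂Measure.pi (fun l => (μ l).prod fairBoolPair) ≤ D) :
    (Measure.pi μ).real {e | ∃ v, D + t * N ≤ ∑ l, (∫ e', g l v e' ∂μ l - g l v (e l))} ≤
      Real.exp (-(2 * t ^ 2 * N)) := by
  have hS := isSupLike_iSup (ι := ι)
  have hgi : ∀ l v, Integrable (g l v) (μ l) := fun l v =>
    Integrable.of_mem_Icc 0 1 (hg l v).aemeasurable
      (Filter.Eventually.of_forall fun e => ⟨hg0 l v e, hg1 l v e⟩)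
  set d : Fin N → E → ι → ℝ := fun l e v => ∫ e', g l v e' ∂μ l - g l v e with hd
  have hdm : ∀ l, Measurable (d l) := fun l =>
    measurable_pi_iff.2 fun v => (hg l v).const_sub _
  set Y : Fin N → E × Bool × Bool → ι → ℝ := fun l z v =>
    4 * c * (boolSign z.2.1 * x l v z.1 + boolSign z.2.2 * y l v z.1) with hY
  have hYi : ∀ l v, Integrable (fun z => Y l z v) ((μ l).prod fairBoolPair) := fun l v =>
    integrable_boolSign_combo (hx l v) (hy l v) (4 * c)
  -- The value 4t minimises lam²/8 - lam·t, and the minimum is -2t².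
  have main := integral_exp_supLike_sum_le (lam := 4 * t) (by positivity) N μ
    (fun l => (μ l).prod fairBoolPair) d (fun l v => ∫ e', g l v e' ∂μ l - 1) Y hdm
    (fun l e v => by simp only [hd]; linarith [hg1 l v e])
    (fun l e v => by simp only [hd]; linarith [hg0 l v e]) hYi _ hS
    (fun l h => by
      simpa only [hd, hY, Pi.add_apply] using
        integral_iSup_sub_le (hgi l) (hx l) (hy l) (hlip l) hc h)
  simp only [Finset.sum_apply] at main
  have hXm : Measurable fun e : Fin N → E => ⨆ v, ∑ l, d l (e l) v := by
    have : Measurable fun e : Fin N → E => ∑ l, d l (e l) :=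
      Finset.measurable_sum _ fun l _ => (hdm l).comp (measurable_pi_apply l)
    simpa only [Finset.sum_apply, Function.comp_def] using hS.continuous.measurable.comp this
  have hXb : ∀ e : Fin N → E, (⨆ v, ∑ l, d l (e l) v) ≤ N := fun e => ciSup_le fun v => by
    calc ∑ l, d l (e l) v ≤ ∑ _l : Fin N, (1 : ℝ) := Finset.sum_le_sum fun l _ => by
          have : ∫ e', g l v e' ∂μ l ≤ 1 := by
            simpa using integral_mono (hgi l v) (integrable_const (1 : ℝ)) (hg1 l v)
          simp only [hd]; linarith [hg0 l v (e l)]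
      _ = N := by simp
  have hint : Integrable (fun e : Fin N → E => Real.exp (4 * t * ⨆ v, ∑ l, d l (e l) v))
      (Measure.pi μ) :=
    Integrable.of_mem_Icc 0 (Real.exp (4 * t * N)) (hXm.const_mul _).exp.aemeasurable
      (Filter.Eventually.of_forall fun e => ⟨(Real.exp_pos _).le,
        Real.exp_le_exp.2 (mul_le_mul_of_nonneg_left (hXb e) (by positivity))⟩)
  have hmark := measure_ge_le_exp_mul_mgf (μ := Measure.pi μ)
    (X := fun e : Fin N → E => ⨆ v, ∑ l, d l (e l) v) (D + t * N)
    (by positivity : 0 ≤ 4 * t) hint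
  have hsub : (Measure.pi μ).real
      {e | ∃ v, D + t * N ≤ ∑ l, (∫ e', g l v e' ∂μ l - g l v (e l))} ≤
      (Measure.pi μ).real {e | D + t * N ≤ ⨆ v, ∑ l, d l (e l) v} :=
    measureReal_mono fun e ⟨v, hv⟩ => hv.trans
      (le_ciSup (f := fun v => ∑ l, d l (e l) v) (Set.finite_range _).bddAbove v)
  refine (hsub.trans hmark).trans ?_
  refine (mul_le_mul_of_nonneg_left main (Real.exp_pos _).le).trans ?_
  rw [← Real.exp_add, Real.exp_le_exp]
  have := mul_le_mul_of_nonneg_left hD (by positivity : 0 ≤ 4 * t)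
  simp only [hY]
  linarith

end Contraction

/-! ### Maximal inequality over an ℓ₁ ball -/

section MaximalInequality

/-- Averaging over the signs removes the odd part of each exponential, so `f` and `g` need not be
centered. -/
lemma integral_exp_boolSign {E : Type*} [MeasurableSpace E] {μ : Measure E}
    [IsProbabilityMeasure μ] {f g : E → ℝ} (hf : Measurable f) (hg : Measurable g) {η : ℝ}
    (hi : Integrable (fun e => Real.cosh (η * f e) * Real.cosh (η * g e)) μ) :
    Integrable (fun z : E × Bool × Bool =>
      Real.exp (η * (boolSign z.2.1 * f z.1 + boolSign z.2.2 * g z.1))) (μ.prod fairBoolPair) ∧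
    ∫ z, Real.exp (η * (boolSign z.2.1 * f z.1 + boolSign z.2.2 * g z.1))
      ∂(μ.prod fairBoolPair) = ∫ e, Real.cosh (η * f e) * Real.cosh (η * g e) ∂μ := by
  have hle : ∀ (b : Bool) (x : ℝ), Real.exp (η * (boolSign b * x)) ≤ 2 * Real.cosh (η * x) := by
    intro b x
    rw [Real.cosh_eq]
    have h1 := Real.exp_pos (η * x)
    have h2 := Real.exp_pos (-(η * x))
    cases b
    · have : η * (boolSign false * x) = -(η * x) := by simp [boolSign]
      rw [this]; linarith
    · have : η * (boolSign true * x) = η * x := by simp [boolSign]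
      rw [this]; linarith
  have hs : Measurable boolSign := measurable_of_finite _
  have key : Integrable (fun z : E × Bool × Bool =>
      Real.exp (η * (boolSign z.2.1 * f z.1 + boolSign z.2.2 * g z.1)))
      (μ.prod fairBoolPair) := by
    refine Integrable.mono' ((hi.comp_fst fairBoolPair).const_mul 4)
      (Measurable.aestronglyMeasurable (by fun_prop)) (Filter.Eventually.of_forall fun z => ?_)
    rw [Real.norm_eq_abs, abs_of_pos (Real.exp_pos _), mul_add, Real.exp_add]
    calc _ ≤ (2 * Real.cosh (η * f z.1)) * (2 * Real.cosh (η * g z.1)) :=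
          mul_le_mul (hle _ _) (hle _ _) (Real.exp_pos _).le
            (mul_nonneg zero_le_two (Real.cosh_pos _).le)
      _ = _ := by ring
  refine ⟨key, ?_⟩
  rw [integral_prod _ key]
  congr 1
  ext e
  rw [integral_fairBoolPair]
  simp only [boolSign, if_true, Bool.false_eq_true, if_false, Real.cosh_eq, mul_add, Real.exp_add,
    one_mul, neg_mul, mul_neg]
  ring

variable {ι : Type*} [Fintype ι] [Nonempty ι]

/-- The expected supremum of a symmetrized linear process indexed by vectors of bounded
`ℓ₁`-norm. -/
lemma integral_iSup_boolSign_le {n N : ℕ} (hn : 0 < n) {μ : Fin N → Measure (Fin 2 → Fin n → ℝ)}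
    [∀ l, IsProbabilityMeasure (μ l)] {V : ι → Fin n → ℝ} {B c lam A : ℝ}
    (hV : ∀ v, ∑ j, |V v j| ≤ B) (hc : 0 ≤ c) (hlam : 0 < lam) (hA : 0 < A)
    (hint : ∀ l b j, Integrable (fun e => e b j) (μ l))
    (hci : ∀ l j, Integrable (fun e => Real.cosh (lam * e 0 j) * Real.cosh (lam * e 1 j)) (μ l))
    (hcA : ∀ l j, ∫ e, Real.cosh (lam * e 0 j) * Real.cosh (lam * e 1 j) ∂μ l ≤ A) :
    ∫ z, (⨆ v, ∑ l, 4 * c * (boolSign (z l).2.1 * (∑ j, (z l).1 0 j * V v j) +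
      boolSign (z l).2.2 * (∑ j, (z l).1 1 j * V v j)))
        ∂Measure.pi (fun l => (μ l).prod fairBoolPair) ≤
      4 * c * B / lam * Real.log (2 * n * A ^ N) := by
  set π := Measure.pi (fun l => (μ l).prod fairBoolPair) with hπ
  set a : ℝ := 2 * n * A ^ N with ha
  have hn' : (0 : ℝ) < n := by exact_mod_cast hn
  have ha0 : 0 < a := by positivity
  set u : Fin n → (Fin 2 → Fin n → ℝ) × Bool × Bool → ℝ := fun j z =>
    boolSign z.2.1 * z.1 0 j + boolSign z.2.2 * z.1 1 j with hu
  have hfac : ∀ (η : ℝ), (η = lam ∨ η = -lam) → ∀ j,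
      Integrable (fun z => Real.exp (η * ∑ l, u j (z l))) π ∧
        ∫ z, Real.exp (η * ∑ l, u j (z l)) ∂π ≤ A ^ N := by
    intro η hη j
    have hcosh : ∀ x, Real.cosh (η * x) = Real.cosh (lam * x) := by
      rcases hη with rfl | rfl
      · simp
      · intro x; rw [neg_mul, Real.cosh_neg]
    have h1 := fun l => integral_exp_boolSign (μ := μ l) (η := η)
      (f := fun e => e 0 j) (g := fun e => e 1 j) (by fun_prop) (by fun_prop)
      (by simpa only [hcosh] using hci l j)
    have e1 : (fun z : Fin N → (Fin 2 → Fin n → ℝ) × Bool × Bool =>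
        Real.exp (η * ∑ l, u j (z l))) = fun z => ∏ l, Real.exp (η * u j (z l)) := by
      ext z; rw [Finset.mul_sum, Real.exp_sum]
    rw [e1]
    refine ⟨Integrable.fintype_prod_dep (f := fun _ z => Real.exp (η * u j z))
      fun l => (h1 l).1, ?_⟩
    rw [hπ, integral_fintype_prod_eq_prod (f := fun _ z => Real.exp (η * u j z))]
    calc _ ≤ ∏ _l : Fin N, A := Finset.prod_le_prod
          (fun l _ => integral_nonneg fun z => (Real.exp_pos _).le) fun l _ => by
            rw [(h1 l).2]; simpa only [hcosh] using hcA l j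
      _ = A ^ N := by simp
  -- A smooth substitute for the maximum over columns and both signs. The value `a` bounds its mean:
  -- there are 2n terms, each of mean at most A ^ N.
  set S : (Fin N → (Fin 2 → Fin n → ℝ) × Bool × Bool) → ℝ := fun z =>
    ∑ j, (Real.exp (lam * ∑ l, u j (z l)) + Real.exp (-lam * ∑ l, u j (z l))) with hS
  have hj : ∀ j, Integrable (fun z =>
      Real.exp (lam * ∑ l, u j (z l)) + Real.exp (-lam * ∑ l, u j (z l))) π := fun j =>
    (hfac lam (.inl rfl) j).1.add (hfac (-lam) (.inr rfl) j).1
  have hSi : Integrable S π := integrable_finsetSum _ fun j _ => hj j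
  have hSA : ∫ z, S z ∂π ≤ a := by
    simp only [hS]
    rw [integral_finsetSum _ fun j _ => hj j]
    calc _ ≤ ∑ _j : Fin n, (A ^ N + A ^ N) := Finset.sum_le_sum fun j _ => by
          rw [integral_add (hfac lam (.inl rfl) j).1 (hfac (-lam) (.inr rfl) j).1]
          exact add_le_add (hfac lam (.inl rfl) j).2 (hfac (-lam) (.inr rfl) j).2
      _ = a := by simp [ha]; ring
  have hpt : ∀ z v, ∑ l, 4 * c * (boolSign (z l).2.1 * (∑ j, (z l).1 0 j * V v j) +
      boolSign (z l).2.2 * (∑ j, (z l).1 1 j * V v j)) ≤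
      4 * c * B / lam * (Real.log a + S z / a - 1) := by
    intro z v
    -- The tangent of the logarithm at `a` replaces Jensen's inequality. The right side is affine in
    -- `S` and integrates to at most log a.
    have hT : ∀ j, lam * |∑ l, u j (z l)| ≤ Real.log a + S z / a - 1 := by
      intro j
      have h1 : Real.exp (lam * |∑ l, u j (z l)|) ≤ S z := by
        refine le_trans ?_ (Finset.single_le_sum
          (f := fun j => Real.exp (lam * ∑ l, u j (z l)) + Real.exp (-lam * ∑ l, u j (z l)))
          (fun j _ => by positivity) (Finset.mem_univ j))
        rcases abs_cases (∑ l, u j (z l)) with ⟨h, _⟩ | ⟨h, _⟩ <;> rw [h]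
        · linarith [Real.exp_pos (-lam * ∑ l, u j (z l))]
        · rw [mul_neg, ← neg_mul]; linarith [Real.exp_pos (lam * ∑ l, u j (z l))]
      have h0 := Real.exp_pos (lam * |∑ l, u j (z l)|)
      have h2 := Real.log_le_sub_one_of_pos (div_pos h0 ha0)
      rw [Real.log_div h0.ne' ha0.ne', Real.log_exp] at h2
      have h3 : Real.exp (lam * |∑ l, u j (z l)|) / a ≤ S z / a := by gcongr
      linarith
    have hT0 : 0 ≤ Real.log a + S z / a - 1 :=
      le_trans (by positivity) (hT ⟨0, hn⟩)
    have e : ∑ l, 4 * c * (boolSign (z l).2.1 * (∑ j, (z l).1 0 j * V v j) +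
      boolSign (z l).2.2 * (∑ j, (z l).1 1 j * V v j)) =
        4 * c * ∑ j, V v j * ∑ l, u j (z l) := by
      rw [← Finset.mul_sum]
      congr 1
      simp only [Finset.mul_sum, hu]
      rw [Finset.sum_comm]
      refine Finset.sum_congr rfl fun l _ => ?_
      rw [← Finset.sum_add_distrib]
      exact Finset.sum_congr rfl fun j _ => by ring
    rw [e]
    have h4 : ∑ j, V v j * ∑ l, u j (z l) ≤ B * ((Real.log a + S z / a - 1) / lam) := by
      calc ∑ j, V v j * ∑ l, u j (z l) ≤
          ∑ j, |V v j| * ((Real.log a + S z / a - 1) / lam) := Finset.sum_le_sum fun j _ => by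
            refine (le_abs_self _).trans ?_
            rw [abs_mul]
            refine mul_le_mul_of_nonneg_left ?_ (abs_nonneg _)
            rw [le_div_iff₀ hlam, mul_comm]
            exact hT j
        _ = (∑ j, |V v j|) * ((Real.log a + S z / a - 1) / lam) := by rw [Finset.sum_mul]
        _ ≤ _ := mul_le_mul_of_nonneg_right (hV v) (by positivity)
    calc _ ≤ 4 * c * (B * ((Real.log a + S z / a - 1) / lam)) :=
          mul_le_mul_of_nonneg_left h4 (by positivity)
      _ = _ := by ring
  have hB : 0 ≤ B := le_trans (Finset.sum_nonneg fun j _ => abs_nonneg _)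
    (hV (Classical.arbitrary ι))
  have hli : Integrable (fun z => ⨆ v, ∑ l, 4 * c * (boolSign (z l).2.1 *
      (∑ j, (z l).1 0 j * V v j) + boolSign (z l).2.2 * (∑ j, (z l).1 1 j * V v j))) π := by
    have h0 := (isSupLike_iSup (ι := ι)).integrable (ν := π) (Y := fun z v =>
      ∑ l, 4 * c * (boolSign (z l).2.1 * (∑ j, (z l).1 0 j * V v j) +
        boolSign (z l).2.2 * (∑ j, (z l).1 1 j * V v j))) (fun v =>
      integrable_finsetSum _ fun l _ =>
        integrable_pi_eval (fun l => (μ l).prod fairBoolPair) (integrable_boolSign_combo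
          (integrable_finsetSum _ fun j _ => (hint l 0 j).mul_const _)
          (integrable_finsetSum _ fun j _ => (hint l 1 j).mul_const _) (4 * c))) 0
    simpa only [zero_add] using h0
  have hda : Integrable (fun z => Real.log a + S z / a) π :=
    (integrable_const _).add (hSi.div_const a)
  have hri : Integrable (fun z => Real.log a + S z / a - 1) π := hda.sub (integrable_const _)
  refine (integral_mono hli (hri.const_mul (4 * c * B / lam))
    fun z => ciSup_le (hpt z)).trans ?_
  rw [integral_const_mul]
  refine mul_le_mul_of_nonneg_left ?_ (by positivity)
  rw [integral_sub hda (integrable_const _),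
    integral_add (integrable_const _) (hSi.div_const a), integral_div]
  have : (∫ z, S z ∂π) / a ≤ 1 := by rw [div_le_one ha0]; exact hSA
  simp only [integral_const, probReal_univ, one_smul]
  linarith

end MaximalInequality

/-! ### Exponential moments from ψ-norms -/

section Psi

variable {Ω : Type*} [MeasurableSpace Ω] {P : Measure Ω}

lemma psiSet_mono {k : ℕ} {X : Ω → ℝ} {t t' : ℝ} (ht : t ∈ psiSet k X P) (h : t ≤ t') :
    t' ∈ psiSet k X P := by
  refine ⟨ht.1.trans_le h, (lintegral_mono fun ω => ?_).trans ht.2⟩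
  refine ENNReal.ofReal_le_ofReal (Real.exp_le_exp.2 ?_)
  have := ht.1
  gcongr

lemma mem_psiSet_of_psiNorm_lt {k : ℕ} {X : Ω → ℝ} (hX : HasFinitePsiNorm k X P) {t : ℝ}
    (h : psiNorm k X P < t) : t ∈ psiSet k X P := by
  obtain ⟨u, hu, hut⟩ := exists_lt_of_csInf_lt hX h
  exact psiSet_mono hu hut.le

/-- A uniform exponential moment for sub-exponential and sub-gaussian random variables. -/
lemma integral_exp_abs_div_le {k : ℕ} (hk : k = 1 ∨ k = 2) {X : Ω → ℝ} (hX : Measurable X) {t : ℝ}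
    [IsProbabilityMeasure P] (ht : t ∈ psiSet k X P) :
    Integrable (fun ω => Real.exp (|X ω| / t)) P ∧ ∫ ω, Real.exp (|X ω| / t) ∂P ≤ 3 := by
  have ht0 := ht.1
  have hi : Integrable (fun ω => Real.exp (|X ω| ^ k / t ^ k)) P := by
    refine ⟨Measurable.aestronglyMeasurable (by fun_prop), ?_⟩
    rw [hasFiniteIntegral_iff_ofReal (Filter.Eventually.of_forall fun ω => (Real.exp_pos _).le)]
    exact ht.2.trans_lt (by simp)
  have h2 : ∫ ω, Real.exp (|X ω| ^ k / t ^ k) ∂P ≤ 2 := by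
    rw [integral_eq_lintegral_of_nonneg_ae
      (Filter.Eventually.of_forall fun ω => (Real.exp_pos _).le) hi.aestronglyMeasurable]
    exact ENNReal.toReal_le_of_le_ofReal zero_le_two (by simpa using ht.2)
  have h4 : Real.exp (1 / 4) ≤ 3 / 2 := by
    have h5 : Real.exp (1 / 4) ^ 4 ≤ (3 / 2) ^ 4 := by
      rw [← Real.exp_nat_mul]
      norm_num
      linarith [Real.exp_one_lt_d9]
    exact le_of_pow_le_pow_left₀ (by norm_num) (by norm_num) h5
  -- For k = 2 this is x ≤ 1/4 + x². From here on only exponential moments of |X| are used, so both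
  -- values of k are treated alike.
  have hpt : ∀ ω, Real.exp (|X ω| / t) ≤ 3 / 2 * Real.exp (|X ω| ^ k / t ^ k) := by
    intro ω
    calc Real.exp (|X ω| / t) ≤ Real.exp (1 / 4 + |X ω| ^ k / t ^ k) := by
          rw [Real.exp_le_exp, ← div_pow]
          rcases hk with rfl | rfl
          · simp
          · nlinarith [sq_nonneg (|X ω| / t - 1 / 2)]
      _ ≤ _ := by rw [Real.exp_add]; gcongr
  have hi' : Integrable (fun ω => Real.exp (|X ω| / t)) P :=
    Integrable.mono' (hi.const_mul (3 / 2)) (Measurable.aestronglyMeasurable (by fun_prop))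
      (Filter.Eventually.of_forall fun ω => by
        rw [Real.norm_eq_abs, abs_of_pos (Real.exp_pos _)]; exact hpt ω)
  refine ⟨hi', (integral_mono hi' (hi.const_mul _) hpt).trans ?_⟩
  rw [integral_const_mul]
  linarith

lemma integral_exp_abs_add_div_le {X : Ω → ℝ} (hX : Measurable X) {t b B : ℝ}
    [IsProbabilityMeasure P] (ht : 0 < t) (hb : |b| ≤ B)
    (hi : Integrable (fun ω => Real.exp (|X ω| / t)) P)
    (h3 : ∫ ω, Real.exp (|X ω| / t) ∂P ≤ 3) :
    Integrable (fun ω => Real.exp (|b + X ω| / (t + B))) P ∧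
      ∫ ω, Real.exp (|b + X ω| / (t + B)) ∂P ≤ 9 := by
  have hB : 0 ≤ B := (abs_nonneg b).trans hb
  have hpt : ∀ ω, Real.exp (|b + X ω| / (t + B)) ≤ 3 * Real.exp (|X ω| / t) := by
    intro ω
    calc Real.exp (|b + X ω| / (t + B)) ≤ Real.exp (1 + |X ω| / t) := by
          rw [Real.exp_le_exp, div_le_iff₀ (by positivity)]
          have h1 : |b + X ω| ≤ B + |X ω| := (abs_add_le _ _).trans (by linarith)
          have h2 : |X ω| / t * t = |X ω| := div_mul_cancel₀ _ ht.ne'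
          have h3 : 0 ≤ |X ω| / t * B := by positivity
          nlinarith
      _ ≤ _ := by rw [Real.exp_add]; gcongr; linarith [Real.exp_one_lt_d9]
  have hi' : Integrable (fun ω => Real.exp (|b + X ω| / (t + B))) P :=
    Integrable.mono' (hi.const_mul 3) (Measurable.aestronglyMeasurable (by fun_prop))
      (Filter.Eventually.of_forall fun ω => by
        rw [Real.norm_eq_abs, abs_of_pos (Real.exp_pos _)]; exact hpt ω)
  refine ⟨hi', (integral_mono hi' (hi.const_mul _) hpt).trans ?_⟩
  rw [integral_const_mul]
  linarith

/-- Since cosh(ux) - 1 = 2 sinh²(ux/2), the bound sinh y ≤ y·exp y for y ≥ 0 produces the factor u².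
The restriction on u limits the exponential loss to exp(|x|/2), and the other half of exp|x| absorbs
x²/8. -/
lemma cosh_sub_one_le {x u : ℝ} (hu : |u| ≤ 1 / 2) :
    Real.cosh (u * x) ≤ 1 + 4 * u ^ 2 * Real.exp |x| := by
  have h1 : Real.cosh (u * x) - 1 = 2 * Real.sinh (u * x / 2) ^ 2 := by
    have h := Real.cosh_two_mul (u * x / 2)
    rw [mul_div_cancel₀ _ (two_ne_zero)] at h
    rw [h, Real.cosh_sq]
    ring
  have h2 : |Real.sinh (u * x / 2)| ≤ |u * x / 2| * Real.exp |u * x / 2| := by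
    rw [Real.abs_sinh]
    set y := |u * x / 2| with hy
    have hy0 : 0 ≤ y := abs_nonneg _
    have : Real.sinh y = (Real.exp y - Real.exp (-y)) / 2 := Real.sinh_eq y
    rw [this]
    have h3 : Real.exp (-y) = Real.exp y * Real.exp (-(2 * y)) := by
      rw [← Real.exp_add]; congr 1; ring
    have h4 := Real.add_one_le_exp (-(2 * y))
    rw [h3]
    nlinarith [Real.exp_pos y]
  have h5 : Real.sinh (u * x / 2) ^ 2 ≤ (u * x / 2) ^ 2 * Real.exp (|x| / 2) := by
    rw [← sq_abs, ← sq_abs (u * x / 2)]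
    calc |Real.sinh (u * x / 2)| ^ 2 ≤ (|u * x / 2| * Real.exp |u * x / 2|) ^ 2 := by gcongr
      _ = |u * x / 2| ^ 2 * Real.exp (2 * |u * x / 2|) := by
          rw [mul_pow, ← Real.exp_nat_mul]; norm_num
      _ ≤ _ := by
          gcongr
          rw [abs_div, abs_mul, abs_two]
          nlinarith [abs_nonneg x]
  have h6 : x ^ 2 / 8 ≤ Real.exp (|x| / 2) := by
    have := Real.quadratic_le_exp_of_nonneg (x := |x| / 2) (by positivity)
    nlinarith [sq_abs x, abs_nonneg x]
  have h7 : Real.exp |x| = Real.exp (|x| / 2) * Real.exp (|x| / 2) := by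
    rw [← Real.exp_add]; congr 1; ring
  rw [h7]
  have h8 : u ^ 2 * (x ^ 2 / 8) * Real.exp (|x| / 2) ≤
      u ^ 2 * Real.exp (|x| / 2) * Real.exp (|x| / 2) := by gcongr
  nlinarith [h8, h5, h1]

lemma integral_cosh_le [IsProbabilityMeasure P] {X : Ω → ℝ} (hX : Measurable X) {L lam A : ℝ}
    (hL : 0 < L) (hlam : |lam * L| ≤ 1 / 2)
    (hi : Integrable (fun ω => Real.exp (|X ω| / L)) P)
    (hA : ∫ ω, Real.exp (|X ω| / L) ∂P ≤ A) :
    Integrable (fun ω => Real.cosh (lam * X ω)) P ∧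
      ∫ ω, Real.cosh (lam * X ω) ∂P ≤ Real.exp (4 * A * (lam * L) ^ 2) := by
  have hpt : ∀ ω, Real.cosh (lam * X ω) ≤ 1 + 4 * (lam * L) ^ 2 * Real.exp (|X ω| / L) := by
    intro ω
    have := cosh_sub_one_le (x := X ω / L) hlam
    rwa [abs_div, abs_of_pos hL, mul_assoc lam L, mul_div_cancel₀ _ hL.ne'] at this
  have hr := (integrable_const (1 : ℝ)).add (hi.const_mul (4 * (lam * L) ^ 2))
  have hi' : Integrable (fun ω => Real.cosh (lam * X ω)) P :=
    Integrable.mono' hr (Measurable.aestronglyMeasurable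
      (Real.continuous_cosh.measurable.comp (hX.const_mul lam)))
      (Filter.Eventually.of_forall fun ω => by
        rw [Real.norm_eq_abs, abs_of_pos (Real.cosh_pos _)]; exact hpt ω)
  refine ⟨hi', (integral_mono hi' hr hpt).trans ?_⟩
  simp only [Pi.add_apply]
  rw [integral_add (integrable_const _) (hi.const_mul _), integral_const_mul]
  simp only [integral_const, probReal_univ, one_smul]
  have := Real.add_one_le_exp (4 * A * (lam * L) ^ 2)
  nlinarith [sq_nonneg (lam * L)]

end Psi

/-! ### Moments of sums of independent variables -/

section Moments

variable {Ω : Type*} [MeasurableSpace Ω] {P : Measure Ω}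

/-- All moments of `X` are finite. -/
def HasAllMoments (X : Ω → ℝ) (P : Measure Ω) : Prop :=
  ∀ k : ℕ, Integrable (fun ω => X ω ^ k) P

lemma indepFun_pow {U W : Ω → ℝ} (h : IndepFun U W P) (a b : ℕ) :
    IndepFun (fun ω => U ω ^ a) (fun ω => W ω ^ b) P :=
  h.comp (φ := fun x : ℝ => x ^ a) (ψ := fun x : ℝ => x ^ b) (by fun_prop) (by fun_prop)

lemma integral_pow_mul_pow {U W : Ω → ℝ} (h : IndepFun U W P) (hU : HasAllMoments U P)
    (hW : HasAllMoments W P) (a b : ℕ) :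
    ∫ ω, U ω ^ a * W ω ^ b ∂P = (∫ ω, U ω ^ a ∂P) * ∫ ω, W ω ^ b ∂P :=
  (indepFun_pow h a b).integral_fun_mul_eq_mul_integral (hU a).aestronglyMeasurable
    (hW b).aestronglyMeasurable

lemma integrable_pow_mul_pow {U W : Ω → ℝ} (h : IndepFun U W P) (hU : HasAllMoments U P)
    (hW : HasAllMoments W P) (a b : ℕ) : Integrable (fun ω => U ω ^ a * W ω ^ b) P :=
  (indepFun_pow h a b).integrable_mul (hU a) (hW b)

lemma HasAllMoments.add {U W : Ω → ℝ} (h : IndepFun U W P) (hU : HasAllMoments U P)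
    (hW : HasAllMoments W P) : HasAllMoments (fun ω => U ω + W ω) P := by
  intro k
  simp only [add_pow]
  exact integrable_finsetSum _ fun i _ => (integrable_pow_mul_pow h hU hW _ _).mul_const _

lemma HasAllMoments.const_mul {U : Ω → ℝ} (hU : HasAllMoments U P) (c : ℝ) :
    HasAllMoments (fun ω => c * U ω) P := by
  intro k
  simp only [mul_pow]
  exact (hU k).const_mul _

lemma HasAllMoments.const_add [IsFiniteMeasure P] {U : Ω → ℝ} (hU : HasAllMoments U P) (c : ℝ) :
    HasAllMoments (fun ω => c + U ω) P := by
  intro k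
  simp only [add_pow]
  exact integrable_finsetSum _ fun i _ => ((hU _).const_mul _).mul_const _

lemma integral_add_pow_of_indepFun [IsProbabilityMeasure P] {U W : Ω → ℝ} (h : IndepFun U W P)
    (hU : HasAllMoments U P) (hW : HasAllMoments W P) (k : ℕ) :
    ∫ ω, (U ω + W ω) ^ k ∂P = ∑ i ∈ Finset.range (k + 1),
      (∫ ω, U ω ^ i ∂P) * (∫ ω, W ω ^ (k - i) ∂P) * k.choose i := by
  simp only [add_pow]
  rw [integral_finsetSum _ fun i _ => (integrable_pow_mul_pow h hU hW _ _).mul_const _]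
  refine Finset.sum_congr rfl fun i _ => ?_
  rw [integral_mul_const, integral_pow_mul_pow h hU hW]

/-- Moments up to order four of a linear combination of independent centered variables with
common variance. -/
lemma moments_sum_of_iIndepFun [IsProbabilityMeasure P] {κ : Type*} {y : κ → Ω → ℝ}
    (hind : iIndepFun y P) (hym : ∀ j, Measurable (y j)) (hy : ∀ j, HasAllMoments (y j) P)
    {s m3 m4 : ℝ} (h1 : ∀ j, ∫ ω, y j ω ∂P = 0) (h2 : ∀ j, ∫ ω, y j ω ^ 2 ∂P = s)
    (h3 : ∀ j, |∫ ω, y j ω ^ 3 ∂P| ≤ m3) (h4 : ∀ j, ∫ ω, y j ω ^ 4 ∂P ≤ m4) (v : κ → ℝ)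
    (S : Finset κ) :
    HasAllMoments (fun ω => ∑ j ∈ S, v j * y j ω) P ∧
    ∫ ω, ∑ j ∈ S, v j * y j ω ∂P = 0 ∧
    ∫ ω, (∑ j ∈ S, v j * y j ω) ^ 2 ∂P = s * ∑ j ∈ S, v j ^ 2 ∧
    |∫ ω, (∑ j ∈ S, v j * y j ω) ^ 3 ∂P| ≤ m3 * ∑ j ∈ S, |v j| ^ 3 ∧
    ∫ ω, (∑ j ∈ S, v j * y j ω) ^ 4 ∂P ≤
      3 * s ^ 2 * (∑ j ∈ S, v j ^ 2) ^ 2 + (m4 - s ^ 2) * ∑ j ∈ S, v j ^ 4 := by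
  classical
  induction S using Finset.induction_on with
  | empty =>
    refine ⟨fun k => ?_, ?_⟩
    · simp
    · simp
  | insert j S hj ih =>
    obtain ⟨i0, i1, i2, i3, i4⟩ := ih
    have hind' : iIndepFun (fun j ω => v j * y j ω) P :=
      hind.comp (fun j x => v j * x) fun j => by fun_prop
    have hI : IndepFun (fun ω => ∑ j ∈ S, v j * y j ω) (fun ω => v j * y j ω) P := by
      have := hind'.indepFun_finsetSum_of_notMem (fun j => (hym j).const_mul (v j)) hj
      convert this using 1
      ext ω
      simp
    have hw := (hy j).const_mul (v j)
    have hexp := integral_add_pow_of_indepFun hI i0 hw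
    have e : ∀ ω, ∑ j ∈ insert j S, v j * y j ω = ∑ j ∈ S, v j * y j ω + v j * y j ω := by
      intro ω; rw [Finset.sum_insert hj, add_comm]
    have w1 : ∫ ω, v j * y j ω ∂P = 0 := by rw [integral_const_mul, h1, mul_zero]
    have w2 : ∫ ω, (v j * y j ω) ^ 2 ∂P = v j ^ 2 * s := by
      simp only [mul_pow]; rw [integral_const_mul, h2]
    have w3 : ∫ ω, (v j * y j ω) ^ 3 ∂P = v j ^ 3 * ∫ ω, y j ω ^ 3 ∂P := by
      simp only [mul_pow]; rw [integral_const_mul]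
    have w4 : ∫ ω, (v j * y j ω) ^ 4 ∂P = v j ^ 4 * ∫ ω, y j ω ^ 4 ∂P := by
      simp only [mul_pow]; rw [integral_const_mul]
    simp only [e, Finset.sum_insert hj]
    refine ⟨i0.add hI hw, ?_, ?_, ?_, ?_⟩
    · have := hexp 1
      simp only [Finset.sum_range_succ, Finset.sum_range_zero] at this
      simpa [i1, w1] using this
    · rw [hexp 2]
      simp [Finset.sum_range_succ, i1, i2, w1, w2]
      ring
    · rw [hexp 3]
      simp only [Finset.sum_range_succ, Finset.sum_range_zero]
      simp only [pow_zero, pow_one, tsub_zero, tsub_self, Nat.add_one_sub_one, i1, i2, w1, w2, w3,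
        Nat.reduceSub]
      simp only [integral_const, probReal_univ, one_smul, Nat.choose_self, Nat.choose_zero_right,
        zero_mul, mul_zero, one_mul, mul_one, Nat.cast_one, zero_add, add_zero]
      refine (abs_add_le _ _).trans ?_
      rw [mul_add, abs_mul, abs_pow]
      have := mul_le_mul_of_nonneg_left (h3 j) (by positivity : 0 ≤ |v j| ^ 3)
      linarith
    · rw [hexp 4]
      simp only [Finset.sum_range_succ, Finset.sum_range_zero]
      simp only [pow_zero, pow_one, tsub_zero, tsub_self, Nat.add_one_sub_one, i1, i2, w1, w2, w4,
        Nat.reduceSub]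
      simp only [integral_const, probReal_univ, one_smul, Nat.choose_self, Nat.choose_zero_right,
        zero_mul, mul_zero, one_mul, mul_one, Nat.cast_one, zero_add, add_zero]
      have c2 : ((Nat.choose 4 2 : ℕ) : ℝ) = 6 := by norm_num [Nat.choose]
      rw [c2]
      have := mul_le_mul_of_nonneg_left (h4 j) (by positivity : 0 ≤ v j ^ 4)
      -- The sharp coefficient of the sum of fourth powers would be m4 - 3s². Giving away 2s² makes
      -- it nonnegative as soon as s² ≤ m4.
      nlinarith [this, i4, sq_nonneg (s * v j ^ 2)]

end Moments

/-! ### Small ball estimate -/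

section SmallBall

/-- The piecewise linear function which vanishes on `[-ξ, ξ]` and equals one outside
`[-2ξ, 2ξ]`. -/
noncomputable def ramp (ξ x : ℝ) : ℝ := max 0 (min 1 (|x| / ξ - 1))

lemma ramp_nonneg (ξ x : ℝ) : 0 ≤ ramp ξ x := le_max_left _ _

lemma ramp_le_one (ξ x : ℝ) : ramp ξ x ≤ 1 := max_le zero_le_one (min_le_left _ _)

lemma measurable_ramp (ξ : ℝ) : Measurable (ramp ξ) := by
  unfold ramp; fun_prop

lemma ramp_eq_one {ξ x : ℝ} (hξ : 0 < ξ) (hx : 2 * ξ ≤ |x|) : ramp ξ x = 1 := by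
  have : 1 ≤ |x| / ξ - 1 := by
    rw [le_sub_iff_add_le, le_div_iff₀ hξ]; linarith
  rw [ramp, min_eq_left this, max_eq_right zero_le_one]

lemma ramp_le_sq {ξ x : ℝ} : ramp ξ x ≤ x ^ 2 / ξ ^ 2 := by
  rw [ramp, ← sq_abs, ← div_pow]
  refine max_le (by positivity) ((min_le_right _ _).trans ?_)
  nlinarith [sq_nonneg (|x| / ξ - 1 / 2)]

lemma abs_ramp_sub_le {ξ : ℝ} (hξ : 0 < ξ) (x y : ℝ) :
    |ramp ξ x - ramp ξ y| ≤ ξ⁻¹ * |x - y| := by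
  have h1 : |ramp ξ x - ramp ξ y| ≤ |min 1 (|x| / ξ - 1) - min 1 (|y| / ξ - 1)| := by
    unfold ramp
    simpa using abs_max_sub_max_le_max 0 (min 1 (|x| / ξ - 1)) 0 (min 1 (|y| / ξ - 1))
  have h2 : |min 1 (|x| / ξ - 1) - min 1 (|y| / ξ - 1)| ≤ |(|x| / ξ - 1) - (|y| / ξ - 1)| := by
    simpa using abs_min_sub_min_le_max 1 (|x| / ξ - 1) 1 (|y| / ξ - 1)
  have h3 : (|x| / ξ - 1) - (|y| / ξ - 1) = ξ⁻¹ * (|x| - |y|) := by field_simp; ring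
  rw [h3, abs_mul, abs_of_pos (inv_pos.2 hξ)] at h2
  refine (h1.trans h2).trans ?_
  exact mul_le_mul_of_nonneg_left (abs_abs_sub_abs_le x y) (inv_nonneg.2 hξ.le)

variable {Ω : Type*} [MeasurableSpace Ω] {P : Measure Ω} [IsProbabilityMeasure P]

/-- A Paley–Zygmund inequality for the second and fourth moments. -/
lemma paleyZygmund_ramp {X : Ω → ℝ} (hXm : Measurable X) (hX : HasAllMoments X P) {e F θ ξ : ℝ}
    (he : ∫ ω, X ω ^ 2 ∂P = e) (hF : ∫ ω, X ω ^ 4 ∂P ≤ F) (hF0 : 0 < F) (hθ0 : 0 ≤ θ)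
    (hθ1 : θ ≤ 1) (hξ : 0 < ξ) (hξe : 4 * ξ ^ 2 ≤ θ * e) :
    (1 - θ) ^ 2 * (e ^ 2 / F) ≤ ∫ ω, ramp ξ (X ω) ∂P := by
  have he0 : 0 ≤ e := he ▸ integral_nonneg fun ω => sq_nonneg _
  set α := (1 - θ) * e / F with hα
  have hα0 : 0 ≤ α := by
    have : 0 ≤ 1 - θ := by linarith
    positivity
  -- The function 2w - w² is at most 1 everywhere and at most 0 for w ≤ 0, so with w = α(X² - θe) it
  -- lies below the ramp. Integrating it replaces Cauchy–Schwarz, and α is chosen so that the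
  -- resulting bound is (1 - θ)²e²/F.
  have hpt : ∀ ω, 2 * α * X ω ^ 2 - 2 * α * θ * e - α ^ 2 * X ω ^ 4
      + 2 * α ^ 2 * θ * e * X ω ^ 2 - α ^ 2 * θ ^ 2 * e ^ 2 ≤ ramp ξ (X ω) := by
    intro ω
    set w := α * (X ω ^ 2 - θ * e) with hw
    have e1 : 2 * α * X ω ^ 2 - 2 * α * θ * e - α ^ 2 * X ω ^ 4
      + 2 * α ^ 2 * θ * e * X ω ^ 2 - α ^ 2 * θ ^ 2 * e ^ 2 = 2 * w - w ^ 2 := by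
      rw [hw]; ring
    rw [e1]
    rcases le_total (θ * e) (X ω ^ 2) with h | h
    · have : 2 * ξ ≤ |X ω| := by
        refine le_of_pow_le_pow_left₀ two_ne_zero (abs_nonneg _) ?_
        rw [sq_abs]; linarith
      rw [ramp_eq_one hξ this]
      nlinarith [sq_nonneg (w - 1)]
    · have : w ≤ 0 := mul_nonpos_of_nonneg_of_nonpos hα0 (by linarith)
      nlinarith [ramp_nonneg ξ (X ω), sq_nonneg w]
  have i2 := hX 2
  have i4 := hX 4
  have ir : Integrable (fun ω => ramp ξ (X ω)) P :=
    Integrable.of_mem_Icc 0 1 ((measurable_ramp ξ).comp hXm).aemeasurable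
      (Filter.Eventually.of_forall fun ω => ⟨ramp_nonneg _ _, ramp_le_one _ _⟩)
  have j1 : Integrable (fun ω => 2 * α * X ω ^ 2 - 2 * α * θ * e) P :=
    (i2.const_mul _).sub (integrable_const _)
  have j2 : Integrable (fun ω => 2 * α * X ω ^ 2 - 2 * α * θ * e - α ^ 2 * X ω ^ 4) P :=
    j1.sub (i4.const_mul _)
  have j3 : Integrable (fun ω => 2 * α * X ω ^ 2 - 2 * α * θ * e - α ^ 2 * X ω ^ 4
      + 2 * α ^ 2 * θ * e * X ω ^ 2) P := j2.add (i2.const_mul _)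
  have key := integral_mono (j3.sub (integrable_const (α ^ 2 * θ ^ 2 * e ^ 2))) ir hpt
  simp only [Pi.sub_apply] at key
  rw [integral_sub j3 (integrable_const _), integral_add j2 (i2.const_mul _),
    integral_sub j1 (i4.const_mul _), integral_sub (i2.const_mul _) (integrable_const _)] at key
  simp only [integral_const_mul, integral_const, probReal_univ, one_smul, he] at key
  refine le_trans ?_ key
  have h5 : α ^ 2 * ∫ ω, X ω ^ 4 ∂P ≤ α ^ 2 * F := by gcongr
  have h6 : α * F = (1 - θ) * e := by rw [hα]; field_simp
  have h7 : (1 - θ) ^ 2 * (e ^ 2 / F) = α * ((1 - θ) * e) := by rw [hα]; field_simp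
  have h8 : 0 ≤ α ^ 2 * e ^ 2 * (θ * (2 - θ)) := by
    have : 0 ≤ 2 - θ := by linarith
    positivity
  rw [h7]
  nlinarith

/-- Makes the Paley–Zygmund ratio independent of the shift `a`. The third-moment term is absorbed by
two applications of AM–GM, 4s ≤ (1 + s)² and 4a²s ≤ (a² + s)², whence the weight (1 + s)m3 in K. The
constant 3/2 is attained at a = 0, m3 = 0, m4 = s². -/
lemma fourth_moment_comparison {a s m3 m4 : ℝ} (hs : 0 < s) (hm3 : 0 ≤ m3) (h42 : s ^ 2 ≤ m4) :
    2 * (a ^ 4 + 6 * a ^ 2 * s + 4 * |a| * m3 + 2 * s ^ 2 + m4) * s ^ 2 ≤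
      3 * (s ^ 2 + m3 + s * m3 + m4) * (a ^ 2 + s) ^ 2 := by
  have h0 : 0 ≤ m4 - s ^ 2 := by linarith
  have t3 : 8 * |a| * s ^ 2 ≤ 3 * (1 + s) * (a ^ 2 + s) ^ 2 := by
    have ha0 := abs_nonneg a
    rw [← sq_abs a]
    set A := |a|
    have q1 : 4 * s ≤ (1 + s) ^ 2 := by nlinarith [sq_nonneg (1 - s)]
    have q2 : 4 * A ^ 2 * s ≤ (A ^ 2 + s) ^ 2 := by nlinarith [sq_nonneg (A ^ 2 - s)]
    have q3 : (4 * s) * (4 * A ^ 2 * s) ≤ (1 + s) ^ 2 * (A ^ 2 + s) ^ 2 := by gcongr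
    have q4 : 4 * A * s ≤ (1 + s) * (A ^ 2 + s) := by
      refine le_of_pow_le_pow_left₀ two_ne_zero (by positivity) ?_
      rw [mul_pow (1 + s)]
      linarith
    have q5 : s ≤ A ^ 2 + s := by linarith [sq_nonneg A]
    have q6 : (4 * A * s) * s ≤ (1 + s) * (A ^ 2 + s) * (A ^ 2 + s) := by gcongr
    have q7 : 0 ≤ A * s ^ 2 := by positivity
    linarith
  have t4 := mul_le_mul_of_nonneg_right t3 hm3
  have t1 : 0 ≤ (m4 - s ^ 2) * (a ^ 2 * s) := by positivity
  have t2 : 0 ≤ (m4 - s ^ 2) * s ^ 2 := by positivity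
  have t5 : 0 ≤ (m4 - s ^ 2) * a ^ 4 := by positivity
  have t6 : 0 ≤ a ^ 4 * s ^ 2 := by positivity
  linarith

/-- Small ball estimate for a linear combination of independent variables with common variance,
shifted by constants. -/
lemma le_integral_ramp_sum {n : ℕ} {r : Fin n → Ω → ℝ} (hind : iIndepFun r P)
    (hrm : ∀ j, Measurable (r j)) (hr : ∀ j, HasAllMoments (r j) P) {s m3 m4 K ξ : ℝ}
    (hs : 0 < s) (h2 : ∀ j, centralMoment (r j) 2 P = s) (h3 : ∀ j, |centralMoment (r j) 3 P| ≤ m3)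
    (h4 : ∀ j, centralMoment (r j) 4 P ≤ m4) (h42 : s ^ 2 ≤ m4)
    (hK : K = s ^ 2 + m3 + s * m3 + m4) (hξ : 0 < ξ) (hξs : 400 * ξ ^ 2 = s)
    (b v : Fin n → ℝ) (hv : ∑ j, v j ^ 2 = 1) :
    13 / 20 * (s ^ 2 / K) ≤ ∫ ω, ramp ξ (∑ j, (b j + r j ω) * v j) ∂P := by
  have hn : ∃ j : Fin n, True := by
    by_contra h
    push Not at h
    have : ∑ j, v j ^ 2 = 0 := Finset.sum_eq_zero fun j _ => (h j).elim
    linarith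
  obtain ⟨j0, -⟩ := hn
  have hm3 : 0 ≤ m3 := (abs_nonneg _).trans (h3 j0)
  have hri : ∀ j, Integrable (r j) P := fun j => by simpa using hr j 1
  set y : Fin n → Ω → ℝ := fun j ω => -(∫ ω, r j ω ∂P) + r j ω with hy
  have hyind : iIndepFun y P := hind.comp (fun j x => -(∫ ω, r j ω ∂P) + x) fun j => by fun_prop
  have hycm : ∀ j k, ∫ ω, y j ω ^ k ∂P = centralMoment (r j) k P := by
    intro j k
    simp only [centralMoment, hy, Pi.pow_apply, Pi.sub_apply]
    congr 1
    ext ω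
    ring
  have hY := moments_sum_of_iIndepFun hyind (fun j => (hrm j).const_add _)
    (fun j => (hr j).const_add _) (s := s) (m3 := m3) (m4 := m4)
    (fun j => by simp only [hy]; rw [integral_add (integrable_const _) (hri j)]; simp)
    (fun j => (hycm j 2).trans (h2 j)) (fun j => by rw [hycm]; exact h3 j)
    (fun j => by rw [hycm]; exact h4 j) v Finset.univ
  obtain ⟨a0, a1, a2, a3, a4⟩ := hY
  set Y : Ω → ℝ := fun ω => ∑ j, v j * y j ω with hYdef
  set a : ℝ := ∑ j, (b j + ∫ ω, r j ω ∂P) * v j with ha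
  have hX : ∀ ω, ∑ j, (b j + r j ω) * v j = a + Y ω := by
    intro ω
    simp only [ha, hYdef, hy, ← Finset.sum_add_distrib]
    exact Finset.sum_congr rfl fun j _ => by ring
  simp only [hX]
  have hv4 : ∑ j, v j ^ 4 ≤ 1 := by
    calc ∑ j, v j ^ 4 = ∑ j, (v j ^ 2) ^ 2 := Finset.sum_congr rfl fun j _ => by ring
      _ ≤ (∑ j, v j ^ 2) ^ 2 := Finset.sum_sq_le_sq_sum_of_nonneg fun j _ => sq_nonneg _
      _ = 1 := by rw [hv]; norm_num
  have hv1 : ∀ j, |v j| ≤ 1 := by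
    intro j
    have := Finset.single_le_sum (f := fun j => v j ^ 2) (fun j _ => sq_nonneg _)
      (Finset.mem_univ j)
    rw [hv] at this
    exact (sq_le_one_iff_abs_le_one _).1 this
  have hv3 : ∑ j, |v j| ^ 3 ≤ 1 := by
    rw [← hv]
    refine Finset.sum_le_sum fun j _ => ?_
    rw [← sq_abs (v j)]
    exact pow_le_pow_of_le_one (abs_nonneg _) (hv1 j) (by norm_num)
  replace a2 : ∫ ω, Y ω ^ 2 ∂P = s := by rw [a2, hv, mul_one]
  rw [hv] at a4
  replace a3 : |∫ ω, Y ω ^ 3 ∂P| ≤ m3 := a3.trans (by nlinarith)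
  replace a4 : ∫ ω, Y ω ^ 4 ∂P ≤ 2 * s ^ 2 + m4 := a4.trans (by nlinarith)
  have hYm : Measurable Y := by
    refine Finset.measurable_sum _ fun j _ => ((hrm j).const_add _).const_mul _
  have m1 : ∫ ω, (a + Y ω) ^ 2 ∂P = a ^ 2 + s := by
    have e : ∀ ω, (a + Y ω) ^ 2 = a ^ 2 + 2 * a * Y ω + Y ω ^ 2 := fun ω => by ring
    have k1 : Integrable Y P := by simpa using a0 1
    have k2 : Integrable (fun ω => a ^ 2 + 2 * a * Y ω) P :=
      (integrable_const _).add (k1.const_mul _)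
    simp only [e]
    rw [integral_add k2 (a0 2),
      integral_add (integrable_const _) (k1.const_mul _), integral_const_mul, a1, a2]
    simp
  have m2 : ∫ ω, (a + Y ω) ^ 4 ∂P ≤ a ^ 4 + 6 * a ^ 2 * s + 4 * |a| * m3 + 2 * s ^ 2 + m4 := by
    have e : ∀ ω, (a + Y ω) ^ 4 =
        a ^ 4 + 4 * a ^ 3 * Y ω + 6 * a ^ 2 * Y ω ^ 2 + 4 * a * Y ω ^ 3 + Y ω ^ 4 :=
      fun ω => by ring
    have k1 : Integrable Y P := by simpa using a0 1
    have k2 : Integrable (fun ω => a ^ 4 + 4 * a ^ 3 * Y ω) P :=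
      (integrable_const _).add (k1.const_mul _)
    have k3 : Integrable (fun ω => a ^ 4 + 4 * a ^ 3 * Y ω + 6 * a ^ 2 * Y ω ^ 2) P :=
      k2.add ((a0 2).const_mul _)
    have k4 : Integrable (fun ω => a ^ 4 + 4 * a ^ 3 * Y ω + 6 * a ^ 2 * Y ω ^ 2
        + 4 * a * Y ω ^ 3) P := k3.add ((a0 3).const_mul _)
    simp only [e]
    rw [integral_add k4 (a0 4), integral_add k3 ((a0 3).const_mul _),
      integral_add k2 ((a0 2).const_mul _), integral_add (integrable_const _) (k1.const_mul _)]
    simp only [integral_const_mul, a1, a2, integral_const, probReal_univ, one_smul]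
    have : a * ∫ ω, Y ω ^ 3 ∂P ≤ |a| * m3 := by
      refine (le_abs_self _).trans ?_
      rw [abs_mul]; gcongr
    linarith
  set F := a ^ 4 + 6 * a ^ 2 * s + 4 * |a| * m3 + 2 * s ^ 2 + m4 with hF
  have hF0 : 0 < F := by
    have : 0 < s ^ 2 := by positivity
    have : 0 ≤ m4 := by linarith
    positivity
  have hK0 : 0 < K := by
    have : 0 < s ^ 2 := by positivity
    have : 0 ≤ m4 := by linarith
    rw [hK]; positivity
  -- The level satisfies 4ξ² = s/100, so θ = 1/100 is admissible for every `a`, and (99/100)²·(2/3)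
  -- > 13/20.
  have hpz := paleyZygmund_ramp (hYm.const_add a) (a0.const_add a) m1 m2 hF0
    (θ := 1 / 100) (by norm_num) (by norm_num) hξ (by nlinarith [sq_nonneg a])
  refine le_trans ?_ hpz
  have main : 2 * F * s ^ 2 ≤ 3 * K * (a ^ 2 + s) ^ 2 := by
    rw [hF, hK]
    exact fourth_moment_comparison hs hm3 h42
  have main' : 2 / 3 * (s ^ 2 / K) ≤ (a ^ 2 + s) ^ 2 / F := by
    have e : 2 / 3 * (s ^ 2 / K) = 2 * F * s ^ 2 / (3 * K) / F := by field_simp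
    rw [e]
    refine div_le_div_of_nonneg_right ?_ hF0.le
    rw [div_le_iff₀ (by positivity)]
    linarith
  have : 0 ≤ s ^ 2 / K := by positivity
  nlinarith

end SmallBall

/-! ### Independence of blocks -/

section Grouping

variable {Ω : Type*} [MeasurableSpace Ω] {P : Measure Ω} [IsProbabilityMeasure P]

/-- Grouping the entries of an independent family indexed by pairs. -/
lemma iIndepFun_curry {ι κ 𝓧 : Type*} [MeasurableSpace 𝓧] {X : ι × κ → Ω → 𝓧}
    (hX : ∀ p, Measurable (X p)) (h : iIndepFun X P) :
    iIndepFun (fun i ω j => X (i, j) ω) P := by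
  have : ∀ p, IsProbabilityMeasure (P.map (X p)) := fun p =>
    Measure.isProbabilityMeasure_map (hX p).aemeasurable
  have hrow : ∀ i, P.map (fun ω j => X (i, j) ω) =
      Measure.infinitePi fun j => P.map (X (i, j)) := fun i =>
    (iIndepFun_iff_map_fun_eq_infinitePi_map (fun j => hX (i, j))).1
      (h.precomp (Prod.mk_right_injective i))
  have hrm : ∀ i, Measurable (fun ω j => X (i, j) ω) := fun i =>
    measurable_pi_iff.2 fun j => hX (i, j)
  rw [iIndepFun_iff_map_fun_eq_infinitePi_map hrm]
  simp only [hrow]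
  have hc := Measure.infinitePi_map_curry (fun i j => P.map (X (i, j)))
  rw [← hc, ← (iIndepFun_iff_map_fun_eq_infinitePi_map hX).1 h,
    Measure.map_map (MeasurableEquiv.measurable _) (measurable_pi_iff.2 hX)]
  rfl

end Grouping

/-! ### Reduction to a lower bound on unit vectors -/

section Deterministic

/-- A lower bound for `A` on unit vectors with small `ℓ₁`-norm implies the robust null space
property. -/
lemma isL2RNSP_of_forall_le {m n : ℕ} {A : Matrix (Fin m) (Fin n) ℝ} {s : ℕ} {ρ τ : ℝ}
    (hs : 1 ≤ s) (hρ0 : 0 < ρ) (hρ1 : ρ < 1) (hτ : 0 < τ)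
    (h : ∀ v : Fin n → ℝ, ∑ j, v j ^ 2 = 1 → ∑ j, |v j| ≤ 2 * √s / ρ →
      1 / τ ^ 2 ≤ ∑ i, (A *ᵥ v) i ^ 2) : IsL2RNSP A s ρ τ := by
  intro S hS v
  by_contra! hlt
  have hs0 : (0 : ℝ) < s := by exact_mod_cast hs
  have hrs : 0 < √(s : ℝ) := Real.sqrt_pos.2 hs0
  set a := √(∑ j ∈ S, v j ^ 2) with ha
  set b := ∑ j ∈ Sᶜ, |v j| with hb
  have hb0 : 0 ≤ b := Finset.sum_nonneg fun j _ => abs_nonneg _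
  have ht0 : 0 ≤ τ * √(∑ i, (A *ᵥ v) i ^ 2) := by positivity
  have hρb : 0 ≤ ρ / √s * b := by positivity
  set W := ∑ j, v j ^ 2 with hW
  have haV : a ≤ √W := Real.sqrt_le_sqrt
    (Finset.sum_le_sum_of_subset_of_nonneg (Finset.subset_univ _) fun j _ _ => sq_nonneg _)
  have ha0 : 0 < a := by linarith
  have hV0 : 0 < √W := ha0.trans_le haV
  have hW0 : 0 < W := Real.sqrt_pos.1 hV0
  have hVV : √W ^ 2 = W := Real.sq_sqrt hW0.le
  have hS1 : ∑ j ∈ S, |v j| ≤ √s * a := by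
    have := Finset.sum_mul_sq_le_sq_mul_sq S (fun _ => (1 : ℝ)) (fun j => |v j|)
    simp only [one_mul, one_pow, Finset.sum_const, nsmul_eq_mul, mul_one, sq_abs] at this
    rw [ha, ← Real.sqrt_mul hs0.le]
    refine Real.le_sqrt_of_sq_le (this.trans ?_)
    gcongr
  -- A violation of the property dominates the ℓ₁ tail by the ℓ₂ head. With Cauchy–Schwarz on `S`
  -- and ρ < 1, this puts `v` in the cone ‖v‖₁ ≤ (2√s/ρ)‖v‖₂.
  have hb1 : b ≤ √s / ρ * a := by
    have h1 : ρ / √s * b ≤ a := by linarith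
    calc b = √s / ρ * (ρ / √s * b) := by field_simp
      _ ≤ _ := by gcongr
  have hS2 : √s * a ≤ √s / ρ * a := by
    have : √s ≤ √s / ρ := by
      rw [le_div_iff₀ hρ0]; nlinarith
    gcongr
  have hl1 : ∑ j, |v j| ≤ 2 * √s / ρ * √W := by
    rw [← Finset.sum_add_sum_compl S]
    have h1 : √s / ρ * a ≤ √s / ρ * √W := by gcongr
    have h2 : 2 * √s / ρ * √W = √s / ρ * √W + √s / ρ * √W := by ring
    linarith
  have key := h (fun j => (√W)⁻¹ * v j)
    (by
      simp only [mul_pow]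
      rw [← Finset.mul_sum, inv_pow, hVV]
      exact inv_mul_cancel₀ hW0.ne')
    (by
      simp only [abs_mul]
      rw [← Finset.mul_sum, abs_of_pos (inv_pos.2 hV0), inv_mul_le_iff₀ hV0]
      linarith)
  have hAv : ∀ i, (A *ᵥ fun j => (√W)⁻¹ * v j) i = (√W)⁻¹ * (A *ᵥ v) i := by
    intro i
    have : (fun j => (√W)⁻¹ * v j) = (√W)⁻¹ • v := rfl
    rw [this, Matrix.mulVec_smul]
    rfl
  simp only [hAv, mul_pow] at key
  rw [← Finset.mul_sum, inv_pow, hVV, inv_mul_eq_div, div_le_div_iff₀ (by positivity) hW0,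
    one_mul] at key
  have : √W ≤ τ * √(∑ i, (A *ᵥ v) i ^ 2) := by
    have h2 := Real.sqrt_le_sqrt key
    rwa [Real.sqrt_mul' _ (by positivity), Real.sqrt_sq hτ.le, mul_comm] at h2
  linarith

end Deterministic

/-! ### From finite families to all vectors -/

section Separable

variable {Ω : Type*} [MeasurableSpace Ω] {P : Measure Ω} [IsProbabilityMeasure P]

/-- A bound which holds for all finite subfamilies of a continuous process holds for the whole
process. -/
lemma measureReal_exists_lt_le_of_finite {T : Type*} [TopologicalSpace T]
    [TopologicalSpace.SeparableSpace T] {X : Ω → T → ℝ} (hX : ∀ ω, Continuous (X ω)) {c p : ℝ}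
    (hp : 0 ≤ p)
    (h : ∀ (k : ℕ) (f : Fin (k + 1) → T), P.real {ω | ∃ i, X ω (f i) < c} ≤ p) :
    P.real {ω | ∃ v, X ω v < c} ≤ p := by
  rcases isEmpty_or_nonempty T with hT | hT
  · simpa using hp
  set f := TopologicalSpace.denseSeq T
  set B : ℕ → Set Ω := fun k => {ω | ∃ i : Fin (k + 1), X ω (f i) < c} with hB
  -- The inequality is strict, so the bad parameters form an open set and a dense sequence meets it.
  have hsub : {ω | ∃ v, X ω v < c} ⊆ ⋃ k, B k := by
    rintro ω ⟨v, hv⟩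
    have ho : IsOpen {v | X ω v < c} := isOpen_lt (hX ω) continuous_const
    obtain ⟨w, hw, k, rfl⟩ :=
      (TopologicalSpace.denseRange_denseSeq T).inter_open_nonempty _ ho ⟨v, hv⟩
    exact Set.mem_iUnion.2 ⟨k, ⟨Fin.last k, by simpa using hw⟩⟩
  have hmono : Monotone B := by
    intro k l hkl ω
    rintro ⟨i, hi⟩
    exact ⟨⟨i, by omega⟩, hi⟩
  have h1 : P (⋃ k, B k) ≤ ENNReal.ofReal p := by
    rw [hmono.measure_iUnion]
    refine iSup_le fun k => ?_
    have := h k (fun i => f i)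
    rw [← ENNReal.ofReal_toReal (measure_ne_top P (B k))]
    exact ENNReal.ofReal_le_ofReal this
  exact ENNReal.toReal_le_of_le_ofReal hp ((measure_mono hsub).trans h1)

end Separable

/-! ### Lower tails for the row process -/

section RowProcess

variable {Ω : Type*} [MeasurableSpace Ω] {P : Measure Ω} [IsProbabilityMeasure P]

/-- Lower tail of the number of large coordinates, for a single vector. -/
lemma measureReal_sum_sq_lt_le {m n : ℕ} {a : Fin m → Ω → Fin n → ℝ}
    (ham : ∀ i, Measurable (a i)) (hind : iIndepFun a P) {ξ q c : ℝ} (hξ : 0 < ξ) (v : Fin n → ℝ)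
    (hq : ∀ i, q ≤ ∫ ω, ramp ξ (∑ j, a i ω j * v j) ∂P) :
    P.real {ω | ∑ i, (∑ j, a i ω j * v j) ^ 2 < ξ ^ 2 * c} ≤
      Real.exp (2 * c - (1 - Real.exp (-2)) * q * m) := by
  set X : Fin m → Ω → ℝ := fun i ω => ramp ξ (∑ j, a i ω j * v j) with hX
  have hφ : Measurable fun x : Fin n → ℝ => ramp ξ (∑ j, x j * v j) :=
    (measurable_ramp ξ).comp (by fun_prop)
  have hXm : ∀ i, Measurable (X i) := fun i => hφ.comp (ham i)
  have hXind : iIndepFun X P := hind.comp (fun _ x => ramp ξ (∑ j, x j * v j)) fun _ => hφ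
  have hXi : ∀ i, Integrable (X i) P := fun i =>
    Integrable.of_mem_Icc 0 1 (hXm i).aemeasurable
      (Filter.Eventually.of_forall fun ω => ⟨ramp_nonneg _ _, ramp_le_one _ _⟩)
  have hXe : ∀ i, Integrable (fun ω => Real.exp (-2 * X i ω)) P := fun i =>
    Integrable.of_mem_Icc 0 1 ((hXm i).const_mul _).exp.aemeasurable
      (Filter.Eventually.of_forall fun ω => ⟨(Real.exp_pos _).le, by
        rw [Real.exp_le_one_iff]
        have : 0 ≤ X i ω := ramp_nonneg _ _
        linarith⟩)
  have hmgf : ∀ i, mgf (X i) P (-2) ≤ Real.exp (-((1 - Real.exp (-2)) * q)) := by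
    intro i
    -- The graph of a convex function lies below its chord over [0, 1].
    have hpt : ∀ ω, Real.exp (-2 * X i ω) ≤ 1 - (1 - Real.exp (-2)) * X i ω := by
      intro ω
      have h0 : 0 ≤ X i ω := ramp_nonneg _ _
      have h1 : X i ω ≤ 1 := ramp_le_one _ _
      have := convexOn_exp.2 (Set.mem_univ 0) (Set.mem_univ (-2))
        (by linarith : 0 ≤ 1 - X i ω) h0 (by ring)
      simp only [smul_eq_mul, mul_zero, zero_add, Real.exp_zero] at this
      rw [mul_comm] at this
      linarith
    have h1 := integral_mono (hXe i) ((integrable_const 1).sub ((hXi i).const_mul _)) hpt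
    simp only [Pi.sub_apply] at h1
    rw [integral_sub (integrable_const _) ((hXi i).const_mul _), integral_const_mul] at h1
    simp only [integral_const, probReal_univ, one_smul] at h1
    have h2 : 0 ≤ 1 - Real.exp (-2) := by
      rw [sub_nonneg, Real.exp_le_one_iff]; norm_num
    have h3 := mul_le_mul_of_nonneg_left (hq i) h2
    have h4 := Real.add_one_le_exp (-((1 - Real.exp (-2)) * q))
    exact h1.trans (by linarith)
  have hsum : Integrable (fun ω => Real.exp (-2 * (∑ i, X i) ω)) P := by
    simp only [Finset.sum_apply]
    refine Integrable.of_mem_Icc 0 1 (Measurable.aemeasurable (by fun_prop))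
      (Filter.Eventually.of_forall fun ω => ⟨(Real.exp_pos _).le, ?_⟩)
    rw [Real.exp_le_one_iff]
    have : 0 ≤ ∑ i, X i ω := Finset.sum_nonneg fun i _ => ramp_nonneg _ _
    linarith
  have hmark := measure_le_le_exp_mul_mgf (μ := P) (X := ∑ i, X i) (t := -2) c (by norm_num) hsum
  rw [hXind.mgf_sum hXm] at hmark
  have hprod : ∏ i, mgf (X i) P (-2) ≤ Real.exp (-((1 - Real.exp (-2)) * q)) ^ m := by
    calc _ ≤ ∏ _i : Fin m, Real.exp (-((1 - Real.exp (-2)) * q)) :=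
          Finset.prod_le_prod (fun i _ => mgf_nonneg) fun i _ => hmgf i
      _ = _ := by simp
  have hsub : P.real {ω | ∑ i, (∑ j, a i ω j * v j) ^ 2 < ξ ^ 2 * c} ≤
      P.real {ω | (∑ i, X i) ω ≤ c} := by
    refine measureReal_mono fun ω hω => ?_
    simp only [Set.mem_ofPred_eq, Finset.sum_apply] at hω ⊢
    have h1 : ∑ i, X i ω ≤ (∑ i, (∑ j, a i ω j * v j) ^ 2) / ξ ^ 2 := by
      rw [Finset.sum_div]
      exact Finset.sum_le_sum fun i _ => ramp_le_sq
    refine h1.trans ?_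
    rw [div_le_iff₀ (by positivity)]
    linarith
  refine (hsub.trans hmark).trans
    ((mul_le_mul_of_nonneg_left hprod (Real.exp_pos _).le).trans (le_of_eq ?_))
  rw [← Real.exp_nat_mul, ← Real.exp_add]
  congr 1
  ring

variable {ι : Type*} [Fintype ι] [Nonempty ι]

/-- Lower tail, uniformly over a finite family of vectors of bounded `ℓ₁`-norm, obtained by
grouping the rows in pairs. -/
lemma measureReal_exists_sum_sq_lt_le {m n N : ℕ} (hn : 0 < n) (hN : N * 2 ≤ m)
    {a : Fin m → Ω → Fin n → ℝ} (ham : ∀ i, Measurable (a i)) (hind : iIndepFun a P)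
    {ξ q B lam A t : ℝ} (hξ : 0 < ξ) (hq1 : q ≤ 1) (hlam : 0 < lam) (hA : 0 < A)
    (ht : 0 ≤ t) {V : ι → Fin n → ℝ} (hV : ∀ v, ∑ j, |V v j| ≤ B)
    (hq : ∀ i v, q ≤ ∫ ω, ramp ξ (∑ j, a i ω j * V v j) ∂P)
    (hint : ∀ i j, Integrable (fun ω => a i ω j) P)
    (hci : ∀ i j, Integrable (fun ω => Real.cosh (lam * a i ω j)) P)
    (hcA : ∀ i j, ∫ ω, Real.cosh (lam * a i ω j) ∂P ≤ A) :
    P.real {ω | ∃ v, ∑ i, (∑ j, a i ω j * V v j) ^ 2 < ξ ^ 2 * (N * (q * (2 - q)) -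
      4 * ξ⁻¹ * B / lam * Real.log (2 * n * (A * A) ^ N) - t * N)} ≤
      Real.exp (-(2 * t ^ 2 * N)) := by
  -- Disjoint pairs of rows; rows beyond the first 2N are dropped, which only decreases the sum of
  -- squares.
  set idx : Fin N × Fin 2 → Fin m := fun p => Fin.castLE hN (finProdFinEquiv p) with hidx
  have hinj : Function.Injective idx :=
    (Fin.castLE_injective hN).comp finProdFinEquiv.injective
  set blk : Fin N → Ω → Fin 2 → Fin n → ℝ := fun l ω b => a (idx (l, b)) ω with hblk
  have hbm : ∀ l, Measurable (blk l) := fun l => measurable_pi_iff.2 fun b => ham _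
  have hbind : iIndepFun blk P :=
    iIndepFun_curry (X := fun p ω => a (idx p) ω) (fun p => ham _) (hind.precomp hinj)
  set μ : Fin N → Measure (Fin 2 → Fin n → ℝ) := fun l => P.map (blk l) with hμ
  have : ∀ l, IsProbabilityMeasure (μ l) := fun l =>
    Measure.isProbabilityMeasure_map (hbm l).aemeasurable
  have hpair : ∀ l, IndepFun (fun ω => blk l ω 0) (fun ω => blk l ω 1) P := fun l =>
    hind.indepFun (i := idx (l, 0)) (j := idx (l, 1)) fun h => by
      have := hinj h
      simp at this
  -- A smooth version of "at least one of the two rows is large". It still lies in [0, 1], so a pair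
  -- costs as much in Hoeffding's lemma as one row, while its mean rises from q to q(2 - q).
  set g : Fin N → ι → (Fin 2 → Fin n → ℝ) → ℝ := fun _ v e =>
    1 - (1 - ramp ξ (∑ j, e 0 j * V v j)) * (1 - ramp ξ (∑ j, e 1 j * V v j)) with hg
  have hr0 : ∀ x, 0 ≤ 1 - ramp ξ x := fun x => by linarith [ramp_le_one ξ x]
  have hr1 : ∀ x, 1 - ramp ξ x ≤ 1 := fun x => by linarith [ramp_nonneg ξ x]
  have hφ : ∀ v, Measurable fun x : Fin n → ℝ => 1 - ramp ξ (∑ j, x j * V v j) := fun v =>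
    ((measurable_ramp ξ).comp (by fun_prop)).const_sub _
  have hgm : ∀ l v, Measurable (g l v) := fun l v =>
    (((hφ v).comp (measurable_pi_apply 0)).mul ((hφ v).comp (measurable_pi_apply 1))).const_sub _
  have hg0 : ∀ l v e, 0 ≤ g l v e := fun l v e => by
    simp only [hg, sub_nonneg]
    exact mul_le_one₀ (hr1 _) (hr0 _) (hr1 _)
  have hg1 : ∀ l v e, g l v e ≤ 1 := fun l v e => by
    simp only [hg, sub_le_self_iff]
    exact mul_nonneg (hr0 _) (hr0 _)
  have hei : ∀ l b j, Integrable (fun e : Fin 2 → Fin n → ℝ => e b j) (μ l) := fun l b j => by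
    rw [hμ, integrable_map_measure (Measurable.aestronglyMeasurable (by fun_prop))
      (hbm l).aemeasurable]
    exact hint (idx (l, b)) j
  have hcoshm : Measurable Real.cosh := Real.continuous_cosh.measurable
  have hcI : ∀ l j, IndepFun (fun ω => Real.cosh (lam * blk l ω 0 j))
      (fun ω => Real.cosh (lam * blk l ω 1 j)) P := fun l j =>
    (hpair l).comp (φ := fun x : Fin n → ℝ => Real.cosh (lam * x j))
      (ψ := fun x : Fin n → ℝ => Real.cosh (lam * x j))
      (hcoshm.comp (by fun_prop)) (hcoshm.comp (by fun_prop))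
  have hccm : ∀ j, Measurable fun e : Fin 2 → Fin n → ℝ =>
      Real.cosh (lam * e 0 j) * Real.cosh (lam * e 1 j) := fun j =>
    (hcoshm.comp (by fun_prop)).mul (hcoshm.comp (by fun_prop))
  have hD := integral_iSup_boolSign_le hn (μ := μ) (V := V) (B := B) (c := ξ⁻¹) (lam := lam)
    (A := A * A) hV (inv_nonneg.2 hξ.le) hlam (mul_pos hA hA) hei
    (fun l j => by
      rw [hμ, integrable_map_measure (hccm j).aestronglyMeasurable (hbm l).aemeasurable]
      exact (hcI l j).integrable_mul (hci _ j) (hci _ j))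
    (fun l j => by
      rw [hμ, integral_map (hbm l).aemeasurable (hccm j).aestronglyMeasurable,
        (hcI l j).integral_fun_mul_eq_mul_integral (hci _ j).aestronglyMeasurable
          (hci _ j).aestronglyMeasurable]
      exact mul_le_mul (hcA _ j) (hcA _ j)
        (integral_nonneg fun ω => (Real.cosh_pos _).le) hA.le)
  have hxi : ∀ l b v, Integrable (fun e : Fin 2 → Fin n → ℝ => ∑ j, e b j * V v j) (μ l) :=
    fun l b v => integrable_finsetSum _ fun j _ => (hei l b j).mul_const _
  have hlip : ∀ (l : Fin N) (e : Fin 2 → Fin n → ℝ) v w, g l v e - g l w e ≤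
      ξ⁻¹ * (|∑ j, e 0 j * V v j - ∑ j, e 0 j * V w j| +
        |∑ j, e 1 j * V v j - ∑ j, e 1 j * V w j|) := by
    intro l e v w
    have a0 := (abs_le.1 (abs_ramp_sub_le hξ (∑ j, e 0 j * V v j) (∑ j, e 0 j * V w j))).2
    have a1 := (abs_le.1 (abs_ramp_sub_le hξ (∑ j, e 1 j * V v j) (∑ j, e 1 j * V w j))).2
    have b0 : 0 ≤ ξ⁻¹ * |∑ j, e 0 j * V v j - ∑ j, e 0 j * V w j| := by positivity
    have b1 : 0 ≤ ξ⁻¹ * |∑ j, e 1 j * V v j - ∑ j, e 1 j * V w j| := by positivity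
    simp only [hg]
    set p0 := ramp ξ (∑ j, e 0 j * V v j)
    set p1 := ramp ξ (∑ j, e 1 j * V v j)
    set w0 := ramp ξ (∑ j, e 0 j * V w j)
    set w1 := ramp ξ (∑ j, e 1 j * V w j)
    have c0 : 0 ≤ 1 - w1 := hr0 _
    have c1 : 1 - w1 ≤ 1 := hr1 _
    have c2 : 0 ≤ 1 - p0 := hr0 _
    have c3 : 1 - p0 ≤ 1 := hr1 _
    have d0 := mul_le_mul_of_nonneg_right a0 c0
    have d1 := mul_le_mul_of_nonneg_left a1 c2
    have d2 := mul_le_of_le_one_right b0 c1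
    have d3 := mul_le_of_le_one_left b1 c3
    linarith
  have main := measureReal_exists_sum_integral_sub_ge_le (μ := μ) (g := g)
    (x := fun _ v e => ∑ j, e 0 j * V v j) (y := fun _ v e => ∑ j, e 1 j * V v j)
    hgm hg0 hg1 (fun l v => hxi l 0 v) (fun l v => hxi l 1 v) hlip (inv_nonneg.2 hξ.le) ht hD
  have hmean : ∀ l v, q * (2 - q) ≤ ∫ e, g l v e ∂μ l := by
    intro l v
    have hri : ∀ i, Integrable (fun ω => ramp ξ (∑ j, a i ω j * V v j)) P := fun i =>
      Integrable.of_mem_Icc 0 1 (Measurable.aemeasurable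
        ((measurable_ramp ξ).comp (by have := ham i; fun_prop)))
        (Filter.Eventually.of_forall fun ω => ⟨ramp_nonneg _ _, ramp_le_one _ _⟩)
    have hri' : ∀ i, Integrable (fun ω => 1 - ramp ξ (∑ j, a i ω j * V v j)) P := fun i =>
      (integrable_const _).sub (hri i)
    have hI : IndepFun (fun ω => 1 - ramp ξ (∑ j, blk l ω 0 j * V v j))
        (fun ω => 1 - ramp ξ (∑ j, blk l ω 1 j * V v j)) P := (hpair l).comp (hφ v) (hφ v)
    have hval : ∀ i, ∫ ω, (1 - ramp ξ (∑ j, a i ω j * V v j)) ∂P ≤ 1 - q := fun i => by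
      rw [integral_sub (integrable_const _) (hri i)]
      simp only [integral_const, probReal_univ, one_smul]
      linarith [hq i v]
    have hnn : ∀ i, 0 ≤ ∫ ω, (1 - ramp ξ (∑ j, a i ω j * V v j)) ∂P := fun i =>
      integral_nonneg fun ω => hr0 _
    rw [hμ, integral_map (hbm l).aemeasurable (hgm l v).aestronglyMeasurable]
    have hm : Integrable (fun ω => (1 - ramp ξ (∑ j, blk l ω 0 j * V v j)) *
        (1 - ramp ξ (∑ j, blk l ω 1 j * V v j))) P := hI.integrable_mul (hri' _) (hri' _)
    simp only [hg]
    rw [integral_sub (integrable_const _) hm,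
      hI.integral_fun_mul_eq_mul_integral (hri' _).aestronglyMeasurable
        (hri' _).aestronglyMeasurable]
    have := mul_le_mul (hval (idx (l, 0))) (hval (idx (l, 1))) (hnn _) (by linarith)
    simp only [integral_const, probReal_univ, one_smul]
    simp only [hblk]
    nlinarith
  have hpi : P.map (fun ω l => blk l ω) = Measure.pi μ :=
    (iIndepFun_iff_map_fun_eq_pi_map fun l => (hbm l).aemeasurable).1 hbind
  refine le_trans ?_ main
  rw [← hpi]
  -- Only this inequality is needed, so the deviation event need not be shown measurable.
  have hle := Measure.le_map_apply (μ := P) (f := fun ω l => blk l ω)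
    (measurable_pi_iff.2 hbm).aemeasurable {e | ∃ v, 4 * ξ⁻¹ * B / lam *
      Real.log (2 * n * (A * A) ^ N) + t * N ≤ ∑ l, (∫ e', g l v e' ∂μ l - g l v (e l))}
  have : IsProbabilityMeasure (P.map (fun ω l => blk l ω)) :=
    Measure.isProbabilityMeasure_map (measurable_pi_iff.2 hbm).aemeasurable
  refine le_trans (measureReal_mono ?_) (ENNReal.toReal_mono (measure_ne_top _ _) hle)
  rintro ω ⟨v, hv⟩
  refine ⟨v, ?_⟩
  rw [Finset.sum_sub_distrib]
  have h1 : N * (q * (2 - q)) ≤ ∑ l, ∫ e', g l v e' ∂μ l := by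
    calc N * (q * (2 - q)) = ∑ _l : Fin N, q * (2 - q) := by simp
      _ ≤ _ := Finset.sum_le_sum fun l _ => hmean l v
  have h2 : ∑ l, g l v (blk l ω) ≤ (∑ i, (∑ j, a i ω j * V v j) ^ 2) / ξ ^ 2 := by
    calc ∑ l, g l v (blk l ω) ≤
        ∑ l, ∑ b : Fin 2, (∑ j, a (idx (l, b)) ω j * V v j) ^ 2 / ξ ^ 2 := by
          refine Finset.sum_le_sum fun l _ => ?_
          rw [Fin.sum_univ_two]
          have e0 := ramp_le_sq (ξ := ξ) (x := ∑ j, a (idx (l, 0)) ω j * V v j)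
          have e1 := ramp_le_sq (ξ := ξ) (x := ∑ j, a (idx (l, 1)) ω j * V v j)
          have f0 := ramp_nonneg ξ (∑ j, a (idx (l, 0)) ω j * V v j)
          have f1 := ramp_nonneg ξ (∑ j, a (idx (l, 1)) ω j * V v j)
          simp only [hg, hblk]
          nlinarith [mul_nonneg f0 f1]
      _ = ∑ p : Fin N × Fin 2, (∑ j, a (idx p) ω j * V v j) ^ 2 / ξ ^ 2 := by
          rw [Fintype.sum_prod_type]
      _ = ∑ i ∈ Finset.univ.map ⟨idx, hinj⟩, (∑ j, a i ω j * V v j) ^ 2 / ξ ^ 2 := by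
          rw [Finset.sum_map]; rfl
      _ ≤ ∑ i, (∑ j, a i ω j * V v j) ^ 2 / ξ ^ 2 :=
          Finset.sum_le_sum_of_subset_of_nonneg (Finset.subset_univ _) fun i _ _ => by positivity
      _ = _ := by rw [Finset.sum_div]
  have h3 : (∑ i, (∑ j, a i ω j * V v j) ^ 2) / ξ ^ 2 ≤ N * (q * (2 - q)) -
      4 * ξ⁻¹ * B / lam * Real.log (2 * n * (A * A) ^ N) - t * N := by
    rw [div_le_iff₀ (by positivity)]
    linarith
  linarith

end RowProcess

/-! ### Consequences of the lower bound on m -/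

section Numeric

/-- Square root of the hypothesis on m. The term 1/τ will serve the target lower bound, the term in
W the width of the process. In this section `s` stands for the variance and `σ` for the sparsity. -/
lemma threshold_bound {m s β τ ρ x W K : ℝ} (hs : 0 < s) (hK : 0 < K) (hτ : 0 < τ) (hρ : 0 < ρ)
    (hx : 0 ≤ x) (hW : 0 ≤ W) (hβ : β = s ^ 2 / K)
    (h : 10 ^ 14 * (K / (s ^ (5 / 2 : ℝ) * τ) * (1 + τ * ρ⁻¹ * x * W)) ^ 2 ≤ m) :
    10 ^ 7 * (1 / τ + ρ⁻¹ * x * W) ≤ √m * β * √s := by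
  have hy : 0 < √s := Real.sqrt_pos.2 hs
  have hpow : s ^ (5 / 2 : ℝ) = s ^ 2 * √s := by
    rw [show (5 / 2 : ℝ) = (2 : ℕ) + 1 / 2 by norm_num, Real.rpow_add hs, Real.rpow_natCast,
      Real.sqrt_eq_rpow]
  set Z := K / (s ^ (5 / 2 : ℝ) * τ) * (1 + τ * ρ⁻¹ * x * W) with hZ
  have h1 : 10 ^ 7 * Z ≤ √m := by
    refine Real.le_sqrt_of_sq_le (le_trans (le_of_eq ?_) h)
    ring
  have h2 : 1 / τ + ρ⁻¹ * x * W = Z * β * √s := by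
    rw [hZ, hβ, hpow]
    field_simp
  rw [h2]
  have h3 : 0 ≤ β * √s := by rw [hβ]; positivity
  calc 10 ^ 7 * (Z * β * √s) = 10 ^ 7 * Z * (β * √s) := by ring
    _ ≤ √m * (β * √s) := by gcongr
    _ = _ := by ring

lemma one_div_sq_le {m s β τ w : ℝ} (hm : 0 ≤ m) (hs : 0 < s) (hτ : 0 < τ)
    (hw : 0 ≤ w) (h : 10 ^ 7 * (1 / τ + w) ≤ √m * β * √s) :
    1 / τ ^ 2 ≤ m * β ^ 2 * s / 10 ^ 14 := by
  have h1 : 10 ^ 7 * (1 / τ) ≤ √m * β * √s := by linarith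
  have h2 := pow_le_pow_left₀ (by positivity) h1 2
  rw [mul_pow, mul_pow, mul_pow, Real.sq_sqrt hm, Real.sq_sqrt hs.le, div_pow, one_pow] at h2
  linarith

/-- The variance is at most 6W², so it cancels against W² in the squared threshold. -/
lemma mul_log_le_of_threshold {m s β τ ρ lg W : ℝ} {σ : ℕ} (hm : 0 ≤ m) (hs : 0 < s)
    (hβ0 : 0 < β) (hβ1 : β ≤ 1 / 2) (hτ : 0 < τ) (hρ0 : 0 < ρ) (hρ1 : ρ < 1) (hσ : 1 ≤ σ)
    (hlg : 0 ≤ lg) (hW : 0 ≤ W) (hsW : s ≤ 6 * W ^ 2)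
    (h : 10 ^ 7 * (1 / τ + ρ⁻¹ * √(σ * lg) * W) ≤ √m * β * √s) : 1000 * lg ≤ m := by
  have hρ : 1 ≤ ρ⁻¹ := (one_le_inv₀ hρ0).2 hρ1.le
  have hσ' : (1 : ℝ) ≤ σ := by exact_mod_cast hσ
  have hτ' : 0 < 1 / τ := by positivity
  have h1 : √lg * W ≤ ρ⁻¹ * √(σ * lg) * W := by
    have : √lg ≤ √(σ * lg) := Real.sqrt_le_sqrt (by nlinarith)
    have : √lg ≤ ρ⁻¹ * √(σ * lg) := by nlinarith [Real.sqrt_nonneg (σ * lg)]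
    gcongr
  have h2 : 10 ^ 7 * (√lg * W) ≤ √m * β * √s := by linarith
  have h3 := pow_le_pow_left₀ (by positivity) h2 2
  rw [mul_pow, mul_pow, mul_pow, mul_pow, Real.sq_sqrt hm, Real.sq_sqrt hs.le,
    Real.sq_sqrt hlg] at h3
  have h4 : β ^ 2 ≤ 1 := by nlinarith
  have h5 : m * β ^ 2 * s ≤ m * 1 * s := by gcongr
  have h6 : lg * s ≤ lg * (6 * W ^ 2) := by gcongr
  have h7 : 1000 * lg * s ≤ m * s := by
    have : 0 ≤ lg * W ^ 2 := by positivity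
    linarith
  exact le_of_mul_le_mul_right h7 hs

/-- The left side is the maximal inequality at λ = √(log n / N)/L, which balances the logarithm of
the number of columns against the quadratic growth of the log-moments; it is of order √N. The
threshold turns one √m into a small multiple of β√N. -/
lemma width_bound {m s β τ ρ lg W L N Λ : ℝ} {σ : ℕ} (hs : 0 < s) (hβ0 : 0 < β)
    (hτ : 0 < τ) (hρ0 : 0 < ρ) (hlg : 0 < lg) (hL0 : 0 < L) (hLW : L ≤ 2 * W)
    (hN : 0 < N) (hNm : m ≤ 3 * N) (hΛ : Λ ≤ 74 * lg)
    (h : 10 ^ 7 * (1 / τ + ρ⁻¹ * √(σ * lg) * W) ≤ √m * β * √s) :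
    4 * (√s / 20)⁻¹ * (2 * √σ / ρ) / (√(lg / N) / L) * Λ ≤ 1 / 50 * β * N := by
  have hy : 0 < √s := Real.sqrt_pos.2 hs
  have hlg' : 0 < √lg := Real.sqrt_pos.2 hlg
  have hN' : 0 < √N := Real.sqrt_pos.2 hN
  have hτ' : 0 < 1 / τ := by positivity
  have hlg2 : √lg * √lg = lg := Real.mul_self_sqrt hlg.le
  have hN2 : √N * √N = N := Real.mul_self_sqrt hN.le
  have hmN : √m ≤ 2 * √N := by
    rw [Real.sqrt_le_left (by positivity), mul_pow, Real.sq_sqrt hN.le]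
    linarith
  have e1 : √(lg / N) = √lg / √N := Real.sqrt_div hlg.le N
  have e2 : √(σ * lg) = √σ * √lg := Real.sqrt_mul (Nat.cast_nonneg σ) lg
  rw [e2] at h
  have h1 : 10 ^ 7 * (ρ⁻¹ * (√σ * √lg) * W) ≤ √m * β * √s := by linarith
  calc 4 * (√s / 20)⁻¹ * (2 * √σ / ρ) / (√(lg / N) / L) * Λ
      ≤ 4 * (√s / 20)⁻¹ * (2 * √σ / ρ) / (√(lg / N) / L) * (74 * lg) := by gcongr
    _ = 11840 / √s * (ρ⁻¹ * (√σ * √lg)) * √N * L := by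
        rw [e1]
        nth_rewrite 2 [← hlg2]
        field_simp
        ring
    _ ≤ 11840 / √s * (ρ⁻¹ * (√σ * √lg)) * √N * (2 * W) := by gcongr
    _ = 23680 / 10 ^ 7 / √s * √N * (10 ^ 7 * (ρ⁻¹ * (√σ * √lg) * W)) := by ring
    _ ≤ 23680 / 10 ^ 7 / √s * √N * (√m * β * √s) := by gcongr
    _ ≤ 23680 / 10 ^ 7 / √s * √N * (2 * √N * β * √s) := by gcongr
    _ = 47360 / 10 ^ 7 * β * (√N * √N) := by field_simp; ring
    _ ≤ 1 / 50 * β * N := by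
        rw [hN2]
        have : 0 < β * N := by positivity
        linarith

end Numeric

/-! ### Moments of single entries -/

section Entries

variable {Ω : Type*} [MeasurableSpace Ω] {P : Measure Ω} [IsProbabilityMeasure P]

lemma hasAllMoments_of_mem_psiSet {k : ℕ} (hk : k = 1 ∨ k = 2) {X : Ω → ℝ} (hX : Measurable X)
    {t : ℝ} (ht : t ∈ psiSet k X P) : HasAllMoments X P := by
  have ht0 := ht.1
  have hi := (integral_exp_abs_div_le hk hX ht).1
  have hle : ∀ (c : ℝ), (c = t⁻¹ ∨ c = -t⁻¹) → Integrable (fun ω => Real.exp (c * X ω)) P := by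
    intro c hc
    refine Integrable.mono' hi (Measurable.aestronglyMeasurable (by fun_prop))
      (Filter.Eventually.of_forall fun ω => ?_)
    rw [Real.norm_eq_abs, abs_of_pos (Real.exp_pos _), Real.exp_le_exp, div_eq_inv_mul]
    refine (le_abs_self _).trans (le_of_eq ?_)
    rw [abs_mul]
    congr 1
    rcases hc with rfl | rfl
    · exact abs_of_pos (inv_pos.2 ht0)
    · rw [abs_neg]; exact abs_of_pos (inv_pos.2 ht0)
  intro j
  exact integrable_pow_of_integrable_exp_mul (inv_pos.2 ht0).ne' (hle _ (.inl rfl))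
    (hle _ (.inr rfl)) j

lemma centralMoment_two_le_of_mem_psiSet {k : ℕ} (hk : k = 1 ∨ k = 2) {X : Ω → ℝ}
    (hX : Measurable X) {t : ℝ} (ht : t ∈ psiSet k X P) : centralMoment X 2 P ≤ 6 * t ^ 2 := by
  have ht0 := ht.1
  have hm := hasAllMoments_of_mem_psiSet hk hX ht
  obtain ⟨hi, h3⟩ := integral_exp_abs_div_le hk hX ht
  have hL2 : MemLp X 2 P := (memLp_two_iff_integrable_sq hX.aestronglyMeasurable).2 (hm 2)
  rw [centralMoment_two_eq_variance hX.aemeasurable, variance_eq_sub hL2]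
  have hpt : ∀ ω, X ω ^ 2 ≤ 2 * t ^ 2 * Real.exp (|X ω| / t) := by
    intro ω
    have h := Real.quadratic_le_exp_of_nonneg (x := |X ω| / t) (by positivity)
    have h0 : 0 ≤ |X ω| / t := by positivity
    have h1 : X ω ^ 2 = t ^ 2 * (|X ω| / t) ^ 2 := by
      rw [div_pow, sq_abs]; field_simp
    rw [h1]
    have h2 : (|X ω| / t) ^ 2 ≤ 2 * Real.exp (|X ω| / t) := by nlinarith
    have h4 : 0 ≤ t ^ 2 := sq_nonneg t
    nlinarith
  have h5 := integral_mono (hm 2) (hi.const_mul (2 * t ^ 2)) hpt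
  rw [integral_const_mul] at h5
  have h6 : 2 * t ^ 2 * ∫ ω, Real.exp (|X ω| / t) ∂P ≤ 2 * t ^ 2 * 3 := by gcongr
  simp only [Pi.pow_apply]
  nlinarith [sq_nonneg (∫ ω, X ω ∂P)]

lemma sq_centralMoment_two_le {X : Ω → ℝ} (hX : HasAllMoments X P) :
    centralMoment X 2 P ^ 2 ≤ centralMoment X 4 P := by
  have hm := hX.const_add (-(∫ ω, X ω ∂P))
  have e : ∀ j, centralMoment X j P = ∫ ω, (-(∫ ω, X ω ∂P) + X ω) ^ j ∂P := by
    intro j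
    simp only [centralMoment, Pi.pow_apply, Pi.sub_apply]
    congr 1
    ext ω
    ring
  rw [e, e]
  set Y : Ω → ℝ := fun ω => -(∫ ω, X ω ∂P) + X ω with hY
  set s := ∫ ω, Y ω ^ 2 ∂P with hs
  have h0 : 0 ≤ ∫ ω, (Y ω ^ 4 - 2 * s * Y ω ^ 2 + s ^ 2) ∂P := by
    refine integral_nonneg fun ω => ?_
    have : Y ω ^ 4 - 2 * s * Y ω ^ 2 + s ^ 2 = (Y ω ^ 2 - s) ^ 2 := by ring
    simp only [this]
    positivity
  have i1 : Integrable (fun ω => Y ω ^ 4 - 2 * s * Y ω ^ 2) P :=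
    (hm 4).sub ((hm 2).const_mul _)
  rw [integral_add i1 (integrable_const _), integral_sub (hm 4) ((hm 2).const_mul _),
    integral_const_mul] at h0
  simp only [integral_const, probReal_univ, one_smul] at h0
  change 0 ≤ ∫ ω, Y ω ^ 4 ∂P - 2 * s * s + s ^ 2 at h0
  change s ^ 2 ≤ ∫ ω, Y ω ^ 4 ∂P
  linarith

end Entries

/-! ### The perturbation bound -/

section Main

variable {Ω : Type*} [MeasurableSpace Ω] {P : Measure Ω} [IsProbabilityMeasure P]

lemma one_sub_le_measureReal_isL2RNSP {m n : ℕ} {A : Ω → Matrix (Fin m) (Fin n) ℝ} {s : ℕ}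
    {ρ τ p : ℝ} (hs : 1 ≤ s) (hρ0 : 0 < ρ) (hρ1 : ρ < 1) (hτ : 0 < τ)
    (h : P.real {ω | ∃ v : {v : Fin n → ℝ // ∑ j, v j ^ 2 = 1 ∧ ∑ j, |v j| ≤ 2 * √s / ρ},
      ∑ i, (∑ j, A ω i j * v.1 j) ^ 2 < 1 / τ ^ 2} ≤ p) :
    1 - p ≤ P.real {ω | IsL2RNSP (A ω) s ρ τ} := by
  set B := {ω | ∃ v : {v : Fin n → ℝ // ∑ j, v j ^ 2 = 1 ∧ ∑ j, |v j| ≤ 2 * √s / ρ},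
      ∑ i, (∑ j, A ω i j * v.1 j) ^ 2 < 1 / τ ^ 2} with hB
  have hun : Set.univ ⊆ {ω | IsL2RNSP (A ω) s ρ τ} ∪ B := by
    intro ω _
    by_cases hω : ω ∈ B
    · exact .inr hω
    · refine .inl (isL2RNSP_of_forall_le hs hρ0 hρ1 hτ fun v h2 h1 => ?_)
      refine not_lt.1 fun hlt => hω ⟨⟨v, h2, h1⟩, ?_⟩
      simpa only [Matrix.mulVec, dotProduct] using hlt
  have h1 : (1 : ℝ) ≤ P.real ({ω | IsL2RNSP (A ω) s ρ τ} ∪ B) := by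
    rw [← probReal_univ (μ := P)]
    exact measureReal_mono hun
  have h2 := measureReal_union_le (μ := P) {ω | IsL2RNSP (A ω) s ρ τ} B
  linarith

/-- The one-column case. -/
lemma measureReal_exists_lt_le_of_single_column {m : ℕ} {a : Fin m → Ω → Fin 1 → ℝ}
    (ham : ∀ i, Measurable (a i)) (hind : iIndepFun a P) {σ β T B : ℝ} (hσ : 0 < σ)
    (hβ0 : 0 < β) (hβ1 : β ≤ 1 / 2)
    (hq : ∀ i (v : Fin 1 → ℝ), ∑ j, v j ^ 2 = 1 →
      13 / 20 * β ≤ ∫ ω, ramp (√σ / 20) (∑ j, a i ω j * v j) ∂P)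
    (hT : T ≤ m * β ^ 2 * σ / 10 ^ 14) :
    P.real {ω | ∃ v : {v : Fin 1 → ℝ // ∑ j, v j ^ 2 = 1 ∧ ∑ j, |v j| ≤ B},
      ∑ i, (∑ j, a i ω j * v.1 j) ^ 2 < T} ≤ Real.exp (-(β ^ 2 * m)) := by
  have hξ : 0 < √σ / 20 := by positivity
  have hm0 : (0 : ℝ) ≤ m := Nat.cast_nonneg m
  -- A unit vector in dimension one is ±1, so no supremum is needed. The exponent is at least
  -- (4/5)(13/20)βm - βm/50 = βm/2, and β ≤ 1/2 gives β²m.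
  have h1 := measureReal_sum_sq_lt_le ham hind (c := β / 100 * m) hξ (fun _ => 1)
    (fun i => hq i _ (by simp))
  refine (measureReal_mono ?_).trans (h1.trans ?_)
  · rintro ω ⟨⟨v, hv, _⟩, hlt⟩
    simp only [Fin.sum_univ_one, Set.mem_ofPred_eq, mul_one] at hv hlt ⊢
    simp only [mul_pow, hv, mul_one] at hlt
    refine (hlt.trans_le hT).trans_le ?_
    rw [div_pow, Real.sq_sqrt hσ.le]
    have : m * β ^ 2 * σ ≤ m * (β / 2) * σ := by
      have : β ^ 2 ≤ β / 2 := by nlinarith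
      gcongr
    have : 0 ≤ m * β * σ := by positivity
    linarith
  · rw [Real.exp_le_exp]
    have he : Real.exp (-2) ≤ 1 / 5 := by
      have h2 : Real.exp 2 = Real.exp 1 * Real.exp 1 := by rw [← Real.exp_add]; norm_num
      have h3 := Real.exp_one_gt_d9
      rw [Real.exp_neg, inv_le_comm₀ (Real.exp_pos _) (by norm_num), h2]
      nlinarith
    have h4 : β * m * (1 / 5 - Real.exp (-2)) ≥ 0 := by
      have : 0 ≤ 1 / 5 - Real.exp (-2) := by linarith
      positivity
    have h5 : β * β * m ≤ β * (1 / 2) * m := by gcongr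
    linarith

/-- The case of at least two columns. -/
lemma measureReal_exists_lt_le_of_two_le {m n s : ℕ} {a : Fin m → Ω → Fin n → ℝ}
    (ham : ∀ i, Measurable (a i)) (hind : iIndepFun a P) {σ β τ ρ W L : ℝ} (hn : 2 ≤ n)
    (hs : 1 ≤ s) (hσ : 0 < σ) (hβ0 : 0 < β) (hβ1 : β ≤ 1 / 2) (hτ : 0 < τ) (hρ0 : 0 < ρ)
    (hρ1 : ρ < 1) (hL0 : 0 < L) (hLW : L ≤ 2 * W) (hσW : σ ≤ 6 * W ^ 2)
    (hq : ∀ i (v : Fin n → ℝ), ∑ j, v j ^ 2 = 1 →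
      13 / 20 * β ≤ ∫ ω, ramp (√σ / 20) (∑ j, a i ω j * v j) ∂P)
    (hint : ∀ i j, Integrable (fun ω => a i ω j) P)
    (hei : ∀ i j, Integrable (fun ω => Real.exp (|a i ω j| / L)) P)
    (he9 : ∀ i j, ∫ ω, Real.exp (|a i ω j| / L) ∂P ≤ 9)
    (h : 10 ^ 7 * (1 / τ + ρ⁻¹ * √(s * Real.log n) * W) ≤ √m * β * √σ) :
    P.real {ω | ∃ v : {v : Fin n → ℝ // ∑ j, v j ^ 2 = 1 ∧ ∑ j, |v j| ≤ 2 * √s / ρ},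
      ∑ i, (∑ j, a i ω j * v.1 j) ^ 2 < 1 / τ ^ 2} ≤ Real.exp (-(β ^ 2 * m)) := by
  have hm0 : (0 : ℝ) ≤ m := Nat.cast_nonneg m
  have hW0 : 0 ≤ W := by linarith
  have hn2 : (2 : ℝ) ≤ n := by exact_mod_cast hn
  have hlog2 : 0.69 < Real.log 2 := by linarith [Real.log_two_gt_d9]
  have hlgle : Real.log 2 ≤ Real.log n := Real.log_le_log two_pos hn2
  set lg := Real.log n with hlg
  have hlg0 : 0 < lg := by linarith
  have hm := mul_log_le_of_threshold hm0 hσ hβ0 hβ1 hτ hρ0 hρ1 hs hlg0.le hW0 hσW h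
  have hT := one_div_sq_le hm0 hσ hτ (by positivity) h
  set N := m / 2 with hNdef
  have hN2 : N * 2 ≤ m := Nat.div_mul_le_self m 2
  have hNm : (m : ℝ) ≤ 2 * N + 1 := by
    have : m ≤ 2 * N + 1 := by omega
    exact_mod_cast this
  have hN0 : (0 : ℝ) < N := by linarith
  have hξ : 0 < √σ / 20 := by positivity
  -- Now (lam·L)² = log n / N, at most 1/4 because m ≥ 1000 log n. The 2N cosh factors contribute 72
  -- log n, and log(2n) ≤ 2 log n brings the total to at most 74 log n.
  set lam := √(lg / N) / L with hlam
  have hlgN : 0 < √(lg / N) := Real.sqrt_pos.2 (by positivity)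
  have hlamL : lam * L = √(lg / N) := div_mul_cancel₀ _ hL0.ne'
  have hlam2 : (lam * L) ^ 2 = lg / N := by rw [hlamL, Real.sq_sqrt (by positivity)]
  have hlamle : |lam * L| ≤ 1 / 2 := by
    rw [hlamL, abs_of_pos hlgN, Real.sqrt_le_left (by norm_num), div_le_iff₀ hN0]
    linarith
  have ham' : ∀ i j, Measurable fun ω => a i ω j := fun i j => measurable_pi_iff.1 (ham i) j
  have hcosh := fun i j => integral_cosh_le (ham' i j) hL0 hlamle (hei i j) (he9 i j)
  set A := Real.exp (4 * 9 * (lam * L) ^ 2) with hA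
  have hΛ : Real.log (2 * n * (A * A) ^ N) ≤ 74 * lg := by
    have e : (A * A) ^ N = Real.exp (72 * lg) := by
      rw [hA, ← Real.exp_add, ← Real.exp_nat_mul, hlam2]
      congr 1
      field_simp
      ring
    rw [e, Real.log_mul (by positivity) (Real.exp_pos _).ne', Real.log_exp,
      Real.log_mul two_ne_zero (by positivity)]
    linarith
  have hwidth := width_bound hσ hβ0 hτ hρ0 hlg0 hL0 hLW hN0 (by linarith) hΛ h
  rw [← hlam] at hwidth
  refine measureReal_exists_lt_le_of_finite (fun ω => ?_) (Real.exp_pos _).le fun k f => ?_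
  · exact continuous_finsetSum _ fun i _ => (continuous_finsetSum _ fun j _ =>
      continuous_const.mul ((continuous_apply j).comp continuous_subtype_val)).pow 2
  -- For β ≤ 1/2 the pair mean is at least 1.088β. Subtracting t = 1.05β and the width 0.02β leaves
  -- more than β/100, while 2t² = 2.205β² yields the exponent β²m because m ≤ 2N + 1 and N is large.
  have main := measureReal_exists_sum_sq_lt_le (N := N) (by omega : 0 < n) hN2 ham hind
    (q := 13 / 20 * β) (lam := lam) (A := A) (t := 21 / 20 * β) hξ (by linarith)
    (by positivity) (Real.exp_pos _) (by positivity) (V := fun i => (f i).1)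
    (fun i => (f i).2.2) (fun i v => hq i _ (f v).2.1) hint (fun i j => (hcosh i j).1)
    (fun i j => (hcosh i j).2)
  refine (measureReal_mono ?_).trans (main.trans ?_)
  · rintro ω ⟨i, hi⟩
    refine ⟨i, hi.trans_le (hT.trans ?_)⟩
    rw [div_pow, Real.sq_sqrt hσ.le]
    have h1 : 1 / 100 * β * N ≤ N * (13 / 20 * β * (2 - 13 / 20 * β)) -
        4 * (√σ / 20)⁻¹ * (2 * √s / ρ) / lam * Real.log (2 * n * (A * A) ^ N) -
        21 / 20 * β * N := by
      have : β * β * N ≤ β * (1 / 2) * N := by gcongr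
      have : 0 ≤ β * N := by positivity
      linarith
    have h2 := mul_le_mul_of_nonneg_left h1 (by positivity : 0 ≤ σ / 20 ^ 2)
    refine le_trans ?_ h2
    have h3 : m * β ^ 2 * σ ≤ 3 * N * (β / 2) * σ := by
      have : β ^ 2 ≤ β / 2 := by nlinarith
      have : (m : ℝ) ≤ 3 * N := by linarith
      gcongr
    have : 0 ≤ σ * β * N := by positivity
    linarith
  · rw [Real.exp_le_exp, neg_le_neg_iff]
    have h3 : (m : ℝ) ≤ 2 * (21 / 20) ^ 2 * N := by linarith
    have h4 := mul_le_mul_of_nonneg_left h3 (sq_nonneg β)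
    linarith

omit [IsProbabilityMeasure P] in
lemma abs_centralMoment_le_matMoment {m n : ℕ} (R : Ω → Matrix (Fin m) (Fin n) ℝ) (p : ℕ)
    (i : Fin m) (j : Fin n) : |centralMoment (fun ω => R ω i j) p P| ≤ matMoment p R P :=
  le_ciSup (f := fun q : Fin m × Fin n => |centralMoment (fun ω => R ω q.1 q.2) p P|)
    (Set.finite_range _).bddAbove (i, j)

omit [IsProbabilityMeasure P] in
lemma matMoment_nonneg {m n : ℕ} (R : Ω → Matrix (Fin m) (Fin n) ℝ) (p : ℕ) :
    0 ≤ matMoment p R P := Real.iSup_nonneg fun _ => abs_nonneg _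

lemma abs_le_entryMaxNorm {m n : ℕ} (M : Matrix (Fin m) (Fin n) ℝ) (i : Fin m) (j : Fin n) :
    |M i j| ≤ entryMaxNorm M :=
  le_ciSup (f := fun q : Fin m × Fin n => |M q.1 q.2|) (Set.finite_range _).bddAbove (i, j)

lemma entryMaxNorm_nonneg {m n : ℕ} (M : Matrix (Fin m) (Fin n) ℝ) : 0 ≤ entryMaxNorm M :=
  Real.iSup_nonneg fun _ => abs_nonneg _

omit [IsProbabilityMeasure P] in
lemma psiNorm_le_matPsiNorm {m n : ℕ} (k : ℕ) (R : Ω → Matrix (Fin m) (Fin n) ℝ)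
    (i : Fin m) (j : Fin n) : psiNorm k (fun ω => R ω i j) P ≤ matPsiNorm k R P :=
  le_ciSup (f := fun q : Fin m × Fin n => psiNorm k (fun ω => R ω q.1 q.2) P)
    (Set.finite_range _).bddAbove (i, j)

omit [IsProbabilityMeasure P] in
lemma centralMoment_two_eq_matMoment {m n : ℕ} {R : Ω → Matrix (Fin m) (Fin n) ℝ}
    (hR : IsCentral 2 R P) (i : Fin m) (j : Fin n) :
    centralMoment (fun ω => R ω i j) 2 P = matMoment 2 R P := by
  have hc : ∀ q : Fin m × Fin n, |centralMoment (fun ω => R ω q.1 q.2) 2 P| =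
      centralMoment (fun ω => R ω i j) 2 P := by
    intro q
    rw [hR 2 (by norm_num) le_rfl q.1 i q.2 j, abs_of_nonneg]
    exact integral_nonneg fun ω => by simp only [Pi.pow_apply]; positivity
  have : Nonempty (Fin m × Fin n) := ⟨(i, j)⟩
  rw [matMoment]
  simp only [hc]
  exact ciSup_const.symm

omit [IsProbabilityMeasure P] in
lemma exists_entry_of_matMoment_pos {m n p : ℕ} {R : Ω → Matrix (Fin m) (Fin n) ℝ}
    (h : 0 < matMoment p R P) : Nonempty (Fin m × Fin n) := by
  by_contra hne
  rw [not_nonempty_iff] at hne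
  rw [matMoment, Real.iSup_of_isEmpty] at h
  exact lt_irrefl _ h

/-- Each admissible t in the definition of the ψ-norm satisfies 6t² ≥ Var. Hence the ψ-norm cannot
vanish, and the variance is controlled by the scale in the threshold. -/
lemma matMoment_two_le {m n k : ℕ} (hk : k = 1 ∨ k = 2) {R : Ω → Matrix (Fin m) (Fin n) ℝ}
    (hR : IsPsiMatrix k R P) (hc : IsCentral 2 R P) (h0 : 0 < matMoment 2 R P) :
    0 < matPsiNorm k R P ∧ matMoment 2 R P ≤ 6 * matPsiNorm k R P ^ 2 := by
  obtain ⟨⟨i, j⟩⟩ := exists_entry_of_matMoment_pos h0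
  set σ := matMoment 2 R P
  have h1 : √(σ / 6) ≤ matPsiNorm k R P := by
    refine le_trans (le_csInf (hR.finitePsi i j) fun t ht => ?_) (psiNorm_le_matPsiNorm k R i j)
    have := centralMoment_two_le_of_mem_psiSet hk (hR.measurable i j) ht
    rw [centralMoment_two_eq_matMoment hc i j] at this
    rw [Real.sqrt_le_left ht.1.le]
    linarith
  have h2 : 0 < √(σ / 6) := Real.sqrt_pos.2 (by positivity)
  refine ⟨h2.trans_le h1, ?_⟩
  have h3 := pow_le_pow_left₀ h2.le h1 2
  rw [Real.sq_sqrt (by positivity)] at h3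
  linarith

omit [IsProbabilityMeasure P] in
lemma matK_nonneg {m n : ℕ} (R : Ω → Matrix (Fin m) (Fin n) ℝ) : 0 ≤ matK R P := by
  have h2 := matMoment_nonneg (P := P) R 2
  have h3 := matMoment_nonneg (P := P) R 3
  have h4 := matMoment_nonneg (P := P) R 4
  unfold matK
  positivity

/-- The robust null space property of a perturbed random matrix, with an explicit constant. -/
theorem one_sub_exp_le_measureReal_isL2RNSP_add {k : ℕ} (hk : k = 1 ∨ k = 2) {m n : ℕ}
    (M : Matrix (Fin m) (Fin n) ℝ) {R : Ω → Matrix (Fin m) (Fin n) ℝ} (hR : IsPsiMatrix k R P)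
    (hc : IsCentral 2 R P) (hσ : 0 < matMoment 2 R P) {s : ℕ} {ρ τ : ℝ} (hs : 1 ≤ s)
    (hρ0 : 0 < ρ) (hρ1 : ρ < 1) (hτ : 0 < τ)
    (h : 10 ^ 14 * (matK R P / (matMoment 2 R P ^ (5 / 2 : ℝ) * τ) *
      (1 + τ * ρ⁻¹ * √((s : ℝ) * Real.log n) * (matPsiNorm k R P + entryMaxNorm M))) ^ 2
        ≤ (m : ℝ)) :
    1 - Real.exp (-(matMoment 2 R P ^ 4 / matK R P ^ 2 * (m : ℝ))) ≤
      P.real {ω | IsL2RNSP (M + R ω) s ρ τ} := by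
  obtain ⟨⟨i₀, j₀⟩⟩ := exists_entry_of_matMoment_pos hσ
  obtain ⟨hψ0, hσψ⟩ := matMoment_two_le hk hR hc hσ
  have hM0 := entryMaxNorm_nonneg M
  set σ := matMoment 2 R P with hσdef
  set ψ := matPsiNorm k R P with hψ
  set m4 := matMoment 4 R P with hm4
  -- Doubling, possible since ψ > 0, avoids asking whether the infimum is attained.
  have hset : ∀ i j, 2 * ψ ∈ psiSet k (fun ω => R ω i j) P := fun i j =>
    mem_psiSet_of_psiNorm_lt (hR.finitePsi i j)
      ((psiNorm_le_matPsiNorm k R i j).trans_lt (by linarith))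
  have hmom : ∀ i j, HasAllMoments (fun ω => R ω i j) P := fun i j =>
    hasAllMoments_of_mem_psiSet hk (hR.measurable i j) (hset i j)
  have hcm4 : ∀ i j, centralMoment (fun ω => R ω i j) 4 P ≤ m4 := fun i j =>
    (le_abs_self _).trans (abs_centralMoment_le_matMoment R 4 i j)
  have h42 : σ ^ 2 ≤ m4 := by
    have := sq_centralMoment_two_le (hmom i₀ j₀)
    rw [centralMoment_two_eq_matMoment hc] at this
    exact this.trans (hcm4 i₀ j₀)
  have hm3 := matMoment_nonneg (P := P) R 3
  have hKdef : matK R P = σ ^ 2 + matMoment 3 R P + σ * matMoment 3 R P + m4 := rfl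
  have hK2 : 2 * σ ^ 2 ≤ matK R P := by
    have : 0 ≤ σ * matMoment 3 R P := by positivity
    linarith
  have hK0 : 0 < matK R P := by
    have : 0 < σ ^ 2 := by positivity
    linarith
  set β := σ ^ 2 / matK R P with hβ
  have hβ0 : 0 < β := by positivity
  have hβ1 : β ≤ 1 / 2 := by rw [hβ, div_le_iff₀ hK0]; linarith
  have hβ2 : σ ^ 4 / matK R P ^ 2 = β ^ 2 := by rw [hβ, div_pow]; ring
  rw [hβ2]
  have hthr := threshold_bound hσ hK0 hτ hρ0 (Real.sqrt_nonneg _)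
    (by positivity : 0 ≤ ψ + entryMaxNorm M) hβ h
  set a : Fin m → Ω → Fin n → ℝ := fun i ω j => M i j + R ω i j with ha
  have ham' : ∀ i j, Measurable fun ω => a i ω j := fun i j => (hR.measurable i j).const_add _
  have ham : ∀ i, Measurable (a i) := fun i => measurable_pi_iff.2 (ham' i)
  have hind : iIndepFun a P := by
    have hr := iIndepFun_curry (X := fun (p : Fin m × Fin n) ω => R ω p.1 p.2)
      (fun p => hR.measurable p.1 p.2) hR.indep
    exact hr.comp (fun i x j => M i j + x j) fun i => by fun_prop
  have hrow : ∀ i, iIndepFun (fun (j : Fin n) ω => R ω i j) P := fun i =>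
    hR.indep.precomp (Prod.mk_right_injective i)
  have hξs : 400 * (√σ / 20) ^ 2 = σ := by
    rw [div_pow, Real.sq_sqrt hσ.le]; ring
  have hq : ∀ i (v : Fin n → ℝ), ∑ j, v j ^ 2 = 1 →
      13 / 20 * β ≤ ∫ ω, ramp (√σ / 20) (∑ j, a i ω j * v j) ∂P := fun i v hv =>
    le_integral_ramp_sum (hrow i) (hR.measurable i) (hmom i) hσ
      (centralMoment_two_eq_matMoment hc i) (abs_centralMoment_le_matMoment R 3 i) (hcm4 i)
      h42 hKdef (by positivity) hξs (M i) v hv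
  have hexp : ∀ i j, Integrable (fun ω => Real.exp (|a i ω j| / (2 * ψ + entryMaxNorm M))) P ∧
      ∫ ω, Real.exp (|a i ω j| / (2 * ψ + entryMaxNorm M)) ∂P ≤ 9 := fun i j =>
    integral_exp_abs_add_div_le (hR.measurable i j) (hset i j).1 (abs_le_entryMaxNorm M i j)
      (integral_exp_abs_div_le hk (hR.measurable i j) (hset i j)).1
      (integral_exp_abs_div_le hk (hR.measurable i j) (hset i j)).2
  refine one_sub_le_measureReal_isL2RNSP (A := fun ω => M + R ω) hs hρ0 hρ1 hτ ?_
  -- For n = 1 the logarithm vanishes and the exponential parameter would be zero, so this case is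
  -- separate.
  rcases Nat.lt_or_ge n 2 with hn | hn
  · have hn1 : n = 1 := by have := j₀.pos; omega
    subst hn1
    exact measureReal_exists_lt_le_of_single_column ham hind hσ hβ0 hβ1 hq
      (one_div_sq_le (Nat.cast_nonneg m) hσ hτ (by positivity) hthr)
  · have hint : ∀ i j, Integrable (fun ω => a i ω j) P := fun i j => by
      simpa only [pow_one] using (hmom i j).const_add (M i j) 1
    refine measureReal_exists_lt_le_of_two_le ham hind (L := 2 * ψ + entryMaxNorm M) hn hs hσ
      hβ0 hβ1 hτ hρ0 hρ1 (by positivity) (by linarith) ?_ hq hint (fun i j => (hexp i j).1)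
      (fun i j => (hexp i j).2) hthr
    refine hσψ.trans ?_
    gcongr
    linarith

end Main

/-! ### Number of measurements and conclusion -/

/-- The sufficient number of measurements is of order `s log (n / s)`. -/
lemma measurements_le {n s : ℕ} {ε ρ τ v κ b σ K W m : ℝ} (hε : 0 < ε)
    (hρ : 0 < ρ) (hτ : 0 < τ) (hv : 0 < v) (hn : 2 ≤ n) (hs : 1 ≤ s)
    (hsn : (s : ℝ) ≤ (n : ℝ) ^ (1 - ε)) (hσ : v ≤ σ) (hK0 : 0 ≤ K) (hK : K ≤ κ) (hW0 : 0 ≤ W)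
    (hW : W ≤ b)
    (hm : (10 ^ 14 * (κ / (v ^ (5 / 2 : ℝ) * τ)) ^ 2 * (4 + 2 * (τ * ρ⁻¹ * b) ^ 2) + 1) / ε *
      (s * Real.log (n / s)) ≤ m) :
    10 ^ 14 * (K / (σ ^ (5 / 2 : ℝ) * τ) * (1 + τ * ρ⁻¹ * √(s * Real.log n) * W)) ^ 2 ≤ m := by
  have hs0 : (1 : ℝ) ≤ s := by exact_mod_cast hs
  have hn0 : (2 : ℝ) ≤ n := by exact_mod_cast hn
  have hlog2 : 0.69 < Real.log 2 := by linarith [Real.log_two_gt_d9]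
  have hlgle : Real.log 2 ≤ Real.log n := Real.log_le_log two_pos hn0
  set lg := Real.log n with hlg
  have hlog : ε * lg ≤ Real.log (n / s) := by
    rw [Real.log_div (by positivity) (by positivity)]
    have := Real.log_le_log (by positivity) hsn
    rw [Real.log_rpow (by positivity)] at this
    linarith
  set Q := κ / (v ^ (5 / 2 : ℝ) * τ) with hQ
  set w := τ * ρ⁻¹ * b with hw
  have hb0 : 0 ≤ b := hW0.trans hW
  have hκ0 : 0 ≤ κ := hK0.trans hK
  have hw0 : 0 ≤ w := by positivity
  have hσ0 : 0 < σ := hv.trans_le hσ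
  have hQ0 : 0 ≤ Q := by positivity
  have h1 : K / (σ ^ (5 / 2 : ℝ) * τ) ≤ Q := by rw [hQ]; gcongr
  set x := √(s * lg) with hx
  have hslg : 0.69 ≤ s * lg := by nlinarith
  have hx2 : x ^ 2 = s * lg := Real.sq_sqrt (by linarith)
  have hx0 : 0 ≤ x := Real.sqrt_nonneg _
  have h2 : 1 + τ * ρ⁻¹ * x * W ≤ 1 + w * x := by
    have : τ * ρ⁻¹ * x * W ≤ τ * ρ⁻¹ * x * b := by gcongr
    rw [hw]; linarith
  have h3 : (K / (σ ^ (5 / 2 : ℝ) * τ) * (1 + τ * ρ⁻¹ * x * W)) ^ 2 ≤ (Q * (1 + w * x)) ^ 2 := by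
    have h5 : 0 ≤ K / (σ ^ (5 / 2 : ℝ) * τ) := by positivity
    have h6 : 0 ≤ 1 + τ * ρ⁻¹ * x * W := by positivity
    gcongr
  -- The constant term is absorbed because n ≥ 2 makes s·log n at least 0.69 > 1/2.
  have h4 : (1 + w * x) ^ 2 ≤ (4 + 2 * w ^ 2) * (s * lg) := by
    rw [← hx2] at hslg ⊢
    nlinarith [sq_nonneg (1 - w * x)]
  have h7 : (10 ^ 14 * Q ^ 2 * (4 + 2 * w ^ 2) + 1) * (s * lg) ≤ m := by
    refine le_trans ?_ hm
    have : (10 ^ 14 * Q ^ 2 * (4 + 2 * w ^ 2) + 1) * (s * lg) =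
        (10 ^ 14 * Q ^ 2 * (4 + 2 * w ^ 2) + 1) / ε * (s * (ε * lg)) := by field_simp
    rw [this]
    gcongr
  have h8 : Q ^ 2 * (1 + w * x) ^ 2 ≤ Q ^ 2 * ((4 + 2 * w ^ 2) * (s * lg)) := by gcongr
  rw [mul_pow Q] at h3
  linarith

theorem mainTheorem3 :
    -- the perturbation bound, with an absolute constant `C`
    (∃ C : ℝ, 0 < C ∧
      ∀ (k : ℕ), k = 1 ∨ k = 2 →
      ∀ (Ω : Type*) [MeasurableSpace Ω] (P : Measure Ω) [IsProbabilityMeasure P]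
        (m n : ℕ) (M : Matrix (Fin m) (Fin n) ℝ) (R : Ω → Matrix (Fin m) (Fin n) ℝ),
        IsPsiMatrix k R P → IsCentral 2 R P → 0 < matMoment 2 R P →
      ∀ (s : ℕ) (ρ τ : ℝ), 1 ≤ s → s ≤ n → 0 < ρ → ρ < 1 → 0 < τ →
        C * (matK R P / (matMoment 2 R P ^ (5 / 2 : ℝ) * τ) *
            (1 + τ * ρ⁻¹ * √((s : ℝ) * Real.log n) *
              (matPsiNorm k R P + entryMaxNorm M))) ^ 2 ≤ (m : ℝ) →
        1 - Real.exp (-(matMoment 2 R P ^ 4 / matK R P ^ 2 * (m : ℝ))) ≤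
          P.real {ω | IsL2RNSP (M + R ω) s ρ τ}) ∧
    -- order `s log (n / s)` measurements suffice when all other quantities are bounded
    -- independently of `s` and `n`, and `s ≤ n ^ (1 - ε)`
    (∀ (ε ρ τ v κ b : ℝ), 0 < ε → ε < 1 → 0 < ρ → ρ < 1 → 0 < τ → 0 < v →
      ∃ C₀ : ℝ, 0 < C₀ ∧
      ∀ (k : ℕ), k = 1 ∨ k = 2 →
      ∀ (Ω : Type*) [MeasurableSpace Ω] (P : Measure Ω) [IsProbabilityMeasure P]
        (m n : ℕ) (M : Matrix (Fin m) (Fin n) ℝ) (R : Ω → Matrix (Fin m) (Fin n) ℝ),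
        IsPsiMatrix k R P → IsCentral 2 R P →
        v ≤ matMoment 2 R P → matK R P ≤ κ → matPsiNorm k R P ≤ b → entryMaxNorm M ≤ b →
      ∀ (s : ℕ), 2 ≤ n → 1 ≤ s → (s : ℝ) ≤ (n : ℝ) ^ (1 - ε) →
        C₀ * ((s : ℝ) * Real.log ((n : ℝ) / s)) ≤ (m : ℝ) →
        1 - Real.exp (-(v ^ 4 / κ ^ 2 * (m : ℝ))) ≤
          P.real {ω | IsL2RNSP (M + R ω) s ρ τ}) := by
  refine ⟨⟨10 ^ 14, by positivity, ?_⟩, ?_⟩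
  · intro k hk Ω _ P _ m n M R hR hc hσ s ρ τ hs _ hρ0 hρ1 hτ h
    exact one_sub_exp_le_measureReal_isL2RNSP_add hk M hR hc hσ hs hρ0 hρ1 hτ h
  · intro ε ρ τ v κ b hε _ hρ0 hρ1 hτ hv
    -- The sum b + b bounds ψ-norm plus entry norm. The summand 1 keeps the constant positive for
    -- arbitrary real κ and b.
    refine ⟨(10 ^ 14 * (κ / (v ^ (5 / 2 : ℝ) * τ)) ^ 2 *
      (4 + 2 * (τ * ρ⁻¹ * (b + b)) ^ 2) + 1) / ε, by positivity, ?_⟩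
    intro k hk Ω _ P _ m n M R hR hc hσ hK hψ hM s hn hs hsn hm
    have hσ0 : 0 < matMoment 2 R P := hv.trans_le hσ
    have hψ0 := (matMoment_two_le hk hR hc hσ0).1
    have hM0 := entryMaxNorm_nonneg M
    have hKn := matK_nonneg (P := P) R
    have hKpos : 0 < matK R P := by
      have h3 := matMoment_nonneg (P := P) R 3
      have h4 := matMoment_nonneg (P := P) R 4
      unfold matK
      positivity
    refine le_trans ?_ (one_sub_exp_le_measureReal_isL2RNSP_add hk M hR hc hσ0 hs hρ0 hρ1 hτ
      (measurements_le hε hρ0 hτ hv hn hs hsn hσ hKn hK (by positivity)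
        (add_le_add hψ hM) hm))
    gcongr
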